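/- \textbf{Problem.} Fix $d\ge 1$. An instance of the constrained $\alpha$-separated red-blue clustering problem consists of $n$ points $P=\{p_1,\dots,p_n\}\subset\mathbb R^d$, a line $\ell=\{a+tv : t\in\mathbb R\}\subset\mathbb R^d$ (given by $a,v\in\mathbb R^d$, $v\neq 0$), integers $p,q\ge 1$ and a real number $\alpha\ge 0$. A \emph{feasible solution with radius of covering} $r\ge 0$ consists of $p$ red centers $c_1,\dots,c_p\in\ell$ and $q$ blue centers $d_1,\dots,d_q\in\ell$ (repetitions allowed) such that $P\subseteq\bigcup_i B(c_i,r)$, $P\subseteq\bigcup_j B(d_j,r)$ (closed Euclidean balls), and $\|c_i-d_j\|\ge\alpha$ for all $i,j$. The optimal radius $r^*$ is the infimum of all $r$ for which a feasible solution exists. \textbf{Model of computation.} A real RAM with integer cells and real cells and indirect addressing, in which memory accesses, comparisons, the operations $+,-$ and halving on integers, and the operations $+,-,\times,/,\sqrt{\cdot}$ on real numbers take one step each (there is no conversion from reals to integers). Centers are output by their parameters $t$ on $\ell$, as a nonempty list of at most $p$ red and a nonempty list of at most $q$ blue centers; the last entry of a list is repeated to reach exactly $p$ and $q$ centers. \textbf{Theorem.}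 There is a real RAM program which, for every such instance, halts and outputs a feasible solution together with its radius of covering $R$, where $R\le 4r^*$. Its running time is $O(n\log^2 n)$: for every $d$ there is a constant $C$, depending only on $d$, such that the program makes at most $C\,(n\log^2 n+1)$ steps on every instance in $\mathbb R^d$ with $n$ points. -/

import Mathlib

/-! ## Real RAM

A real RAM with two kinds of memory cells, integer cells (holding natural numbers, also used as
addresses) and real cells (holding exact real numbers). The cells are grouped in arrays; a program
mentions only finitely many arrays, and the cells of an array are addressed by computed integers
(indirect addressing). Every memory access, arithmetic operation, comparison and constant costs one
step. There is no operation turning a real number into an integer (no floor). -/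

namespace RealRAM

/-- A memory state: `int a i` and `real a i` are the `i`-th cells of the integer array and of the
real array with name `a`. -/
structure Store where
  int : ℕ → ℕ → ℕ
  real : ℕ → ℕ → ℝ

/-- Integer expressions. -/
inductive IExp : Type
  | const (k : ℕ)
  | get (a : ℕ) (i : IExp)
  | add (x y : IExp)
  | sub (x y : IExp)
  | half (x : IExp)

/-- Value of an integer expression. Subtraction is truncated at `0`, halving rounds down. -/
def IExp.eval (s : Store) : IExp → ℕ
  | .const k => k
  | .get a i => s.int a (i.eval s)
  | .add x y => x.eval s + y.eval s
  | .sub x y => x.eval s - y.eval s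
  | .half x => x.eval s / 2

/-- Number of primitive steps needed to evaluate an integer expression. -/
def IExp.cost : IExp → ℕ
  | .const _ => 1
  | .get _ i => i.cost + 1
  | .add x y => x.cost + y.cost + 1
  | .sub x y => x.cost + y.cost + 1
  | .half x => x.cost + 1

/-- Real expressions; the only constants are rational numbers. -/
inductive RExp : Type
  | const (k : ℚ)
  | get (a : ℕ) (i : IExp)
  | add (x y : RExp)
  | sub (x y : RExp)
  | mul (x y : RExp)
  | div (x y : RExp)
  | sqrt (x : RExp)

/-- Value of a real expression. Division by `0` and square roots of negative numbers return `0`;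
a program can test for these cases. -/
noncomputable def RExp.eval (s : Store) : RExp → ℝ
  | .const k => (k : ℝ)
  | .get a i => s.real a (i.eval s)
  | .add x y => x.eval s + y.eval s
  | .sub x y => x.eval s - y.eval s
  | .mul x y => x.eval s * y.eval s
  | .div x y => x.eval s / y.eval s
  | .sqrt x => Real.sqrt (x.eval s)

/-- Number of primitive steps needed to evaluate a real expression. -/
def RExp.cost : RExp → ℕ
  | .const _ => 1
  | .get _ i => i.cost + 1
  | .add x y => x.cost + y.cost + 1
  | .sub x y => x.cost + y.cost + 1
  | .mul x y => x.cost + y.cost + 1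
  | .div x y => x.cost + y.cost + 1
  | .sqrt x => x.cost + 1

/-- Tests: comparisons of integers, comparisons of reals, and Boolean combinations. -/
inductive Test : Type
  | ile (x y : IExp)
  | rle (x y : RExp)
  | not (b : Test)
  | and (b c : Test)

/-- The test succeeds in the given state. -/
def Test.Holds (s : Store) : Test → Prop
  | .ile x y => x.eval s ≤ y.eval s
  | .rle x y => x.eval s ≤ y.eval s
  | .not b => ¬ b.Holds s
  | .and b c => b.Holds s ∧ c.Holds s

/-- Number of primitive steps needed to evaluate a test. -/
def Test.cost : Test → ℕ
  | .ile x y => x.cost + y.cost + 1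
  | .rle x y => x.cost + y.cost + 1
  | .not b => b.cost + 1
  | .and b c => b.cost + c.cost + 1

/-- Programs: `setI a i e` stores the value of `e` in cell `i` of the integer array `a`,
`setR a i e` does so for the real array `a`; further sequential composition, branching, and
`loop b c`, which repeats `c` while `b` holds. -/
inductive Prog : Type
  | skip
  | setI (a : ℕ) (i : IExp) (e : IExp)
  | setR (a : ℕ) (i : IExp) (e : RExp)
  | seq (c₁ c₂ : Prog)
  | branch (b : Test) (c₁ c₂ : Prog)
  | loop (b : Test) (c : Prog)

/-- The state after writing `k` into cell `i` of the integer array `a`. -/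
def Store.writeI (s : Store) (a i k : ℕ) : Store :=
  { s with int := Function.update s.int a (Function.update (s.int a) i k) }

/-- The state after writing `x` into cell `i` of the real array `a`. -/
noncomputable def Store.writeR (s : Store) (a i : ℕ) (x : ℝ) : Store :=
  { s with real := Function.update s.real a (Function.update (s.real a) i x) }

/-- `Exec c s t s'`: started in state `s`, the program `c` halts after exactly `t` steps in
state `s'`. -/
inductive Exec : Prog → Store → ℕ → Store → Prop
  | skip (s : Store) : Exec .skip s 1 s
  | setI (s : Store) (a : ℕ) (i e : IExp) :
      Exec (.setI a i e) s (i.cost + e.cost + 1) (s.writeI a (i.eval s) (e.eval s))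
  | setR (s : Store) (a : ℕ) (i : IExp) (e : RExp) :
      Exec (.setR a i e) s (i.cost + e.cost + 1) (s.writeR a (i.eval s) (e.eval s))
  | seq {c₁ c₂ : Prog} {s s₁ s₂ : Store} {t₁ t₂ : ℕ} :
      Exec c₁ s t₁ s₁ → Exec c₂ s₁ t₂ s₂ → Exec (.seq c₁ c₂) s (t₁ + t₂) s₂
  | branch_true {b : Test} {c₁ c₂ : Prog} {s s' : Store} {t : ℕ} :
      b.Holds s → Exec c₁ s t s' → Exec (.branch b c₁ c₂) s (b.cost + 1 + t) s'
  | branch_false {b : Test} {c₁ c₂ : Prog} {s s' : Store} {t : ℕ} :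
      ¬ b.Holds s → Exec c₂ s t s' → Exec (.branch b c₁ c₂) s (b.cost + 1 + t) s'
  | loop_done {b : Test} {c : Prog} {s : Store} :
      ¬ b.Holds s → Exec (.loop b c) s (b.cost + 1) s
  | loop_step {b : Test} {c : Prog} {s s₁ s₂ : Store} {t₁ t₂ : ℕ} :
      b.Holds s → Exec c s t₁ s₁ → Exec (.loop b c) s₁ t₂ s₂ →
      Exec (.loop b c) s (b.cost + 1 + t₁ + t₂) s₂

end RealRAM

/-! ## Red-blue clustering with centers on a line -/

namespace RedBlue

/-- The point with parameter `t` on the line through `a` with direction `v`. -/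
noncomputable def linePoint {d : ℕ} (a v : EuclideanSpace ℝ (Fin d)) (t : ℝ) :
    EuclideanSpace ℝ (Fin d) :=
  a + t • v

/-- The line through `a` with direction `v` (a line if `v ≠ 0`). -/
def line {d : ℕ} (a v : EuclideanSpace ℝ (Fin d)) : Set (EuclideanSpace ℝ (Fin d)) :=
  Set.range (linePoint a v)

/-- `c` (red centers) and `e` (blue centers), all lying on `L`, form a feasible solution with
radius of covering `r` of the constrained `α`-separated red-blue clustering problem for the
points `P`. -/
def IsFeasibleSolution {d n p q : ℕ} (P : Fin n → EuclideanSpace ℝ (Fin d))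
    (L : Set (EuclideanSpace ℝ (Fin d))) (α r : ℝ)
    (c : Fin p → EuclideanSpace ℝ (Fin d)) (e : Fin q → EuclideanSpace ℝ (Fin d)) : Prop :=
  0 ≤ r ∧
  (∀ i, c i ∈ L) ∧ (∀ j, e j ∈ L) ∧
  Set.range P ⊆ ⋃ i, Metric.closedBall (c i) r ∧
  Set.range P ⊆ ⋃ j, Metric.closedBall (e j) r ∧
  ∀ i j, α ≤ dist (c i) (e j)

/-- The radius `r` is feasible: some `p` red and `q` blue centers form a feasible solution with
radius of covering `r`. -/
def IsFeasibleRadius {d n : ℕ} (P : Fin n → EuclideanSpace ℝ (Fin d))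
    (L : Set (EuclideanSpace ℝ (Fin d))) (p q : ℕ) (α r : ℝ) : Prop :=
  ∃ (c : Fin p → EuclideanSpace ℝ (Fin d)) (e : Fin q → EuclideanSpace ℝ (Fin d)),
    IsFeasibleSolution P L α r c e

/-- The optimal radius `r*`. -/
noncomputable def optRadius {d n : ℕ} (P : Fin n → EuclideanSpace ℝ (Fin d))
    (L : Set (EuclideanSpace ℝ (Fin d))) (p q : ℕ) (α : ℝ) : ℝ :=
  sInf {r : ℝ | IsFeasibleRadius P L p q α r}

/-- The integer input cells: `n`, `d`, `p`, `q` in cells `0`, `1`, `2`, `3` of array `0`. All other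
integer cells are `0`. -/
def inputInt (n d p q : ℕ) : ℕ → ℕ → ℕ
  | 0, 0 => n
  | 0, 1 => d
  | 0, 2 => p
  | 0, 3 => q
  | _, _ => 0

/-- The real input cells: `α` in cell `0` of array `0`; the coordinates of the point `a` and of the
direction `v` in arrays `1` and `2`; coordinate `j` of the `i`-th point (with `i < n`, `j < d`) in
cell `i * d + j` of array `3`. All other real cells are `0`. -/
noncomputable def inputReal {d n : ℕ} (P : Fin n → EuclideanSpace ℝ (Fin d))
    (a v : EuclideanSpace ℝ (Fin d)) (α : ℝ) : ℕ → ℕ → ℝ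
  | 0, 0 => α
  | 1, j => if h : j < d then a ⟨j, h⟩ else 0
  | 2, j => if h : j < d then v ⟨j, h⟩ else 0
  | 3, k =>
      if h : k / d < n ∧ k % d < d then P ⟨k / d, h.1⟩ ⟨k % d, h.2⟩ else 0
  | _, _ => 0

/-- The initial state of the machine on an instance of the problem. -/
noncomputable def inputStore {d n : ℕ} (P : Fin n → EuclideanSpace ℝ (Fin d))
    (a v : EuclideanSpace ℝ (Fin d)) (p q : ℕ) (α : ℝ) : RealRAM.Store where
  int := inputInt n d p q
  real := inputReal P a v α

/-- The sequence of `k` points on the line described by a list of `m` line parameters, stored in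
the cells `0, …, m - 1` of an array: the last point of the list is repeated if `m < k`. -/
noncomputable def centers {d : ℕ} (a v : EuclideanSpace ℝ (Fin d)) (m : ℕ) (cells : ℕ → ℝ)
    (k : ℕ) : Fin k → EuclideanSpace ℝ (Fin d) :=
  fun i => linePoint a v (cells (min (i : ℕ) (m - 1)))

/-- The final state `s` describes `p` red centers and `q` blue centers on the line that form a
feasible solution with radius of covering `R`. Output cells: the lengths (at least `1`) of the lists
of red and of blue centers in cells `0` and `1` of the integer array `1`, the line parameters of the
red and of the blue centers in the real arrays `4` and `5`, and `R` in cell `0` of the real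
array `6`. -/
def OutputsFeasible {d n : ℕ} (P : Fin n → EuclideanSpace ℝ (Fin d))
    (a v : EuclideanSpace ℝ (Fin d)) (p q : ℕ) (α R : ℝ) (s : RealRAM.Store) : Prop :=
  1 ≤ s.int 1 0 ∧ s.int 1 0 ≤ p ∧
  1 ≤ s.int 1 1 ∧ s.int 1 1 ≤ q ∧
  s.real 6 0 = R ∧
  IsFeasibleSolution P (line a v) α R
    (centers a v (s.int 1 0) (s.real 4) p) (centers a v (s.int 1 1) (s.real 5) q)

end RedBlue

/-! The problem is reduced to covering numbers on the real line. Each point is replaced by the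
parameter of its projection to `ℓ`. Let `T` be the sorted parameters, `H` the largest distance of a
point to `ℓ`, `k = min p q` and `β = α / ‖v‖`. Suppose intervals of length `w ≥ 2β`, at most `k` in
number and with left ends more than `w` apart, cover `T`. Moving each midpoint by `β / 2` to the
left for a red center and to the right for a blue one gives a feasible solution of radius `‖v‖ (w +
β) / 2 + H` (`isFeasibleSolution_of_starts`). A feasible radius `r` yields a covering of `T` by `k`
intervals of radius `ρ = r / ‖v‖`, and also `β ≤ 2ρ` and `H ≤ r`. Hence `w ≤ 4ρ` suffices for the
total to be at most `3r + r = 4r` (`le_four_mul_of_isFeasibleRadius`).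

Such a `w` is found by doubling. If greedy covering with length `w` needs more than `k` intervals,
its left ends contain `k + 1` numbers more than `w` apart, and the pigeonhole principle gives `w <
2ρ` (`Starts.lt_two_mul`); doubling therefore keeps `w ≤ 4ρ`. The search starts at the maximum of
`2β` and the `k`-th largest gap `g` of `T` (the smallest entry if `k` exceeds their number). This
gap is at most `2ρ`, because `k` gaps above `2ρ` would give `k + 1` numbers too far apart
(`sorted_gap_le`). Conversely, once `w ≥ n g` the greedy covering has at most `k` intervals: between
consecutive left ends lies a gap larger than `g`, and there are fewer than `k` of these
(`Starts.le_of_gaps`). So about `log n` doublings suffice.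

Each greedy run is linear and the two sorts are merge sorts, so for fixed `d` the cost is `O(n log
n)` up to an additive constant, which is within the claimed bound (`mul_clog_le`). -/

namespace RealRAM

/-! ### Weakest preconditions with step counts -/

/-- Started in state `s`, the program `c` halts after some number `t` of steps in some state `s'`
such that `Q t s'`. -/
def WP (c : Prog) (s : Store) (Q : ℕ → Store → Prop) : Prop :=
  ∃ t s', Exec c s t s' ∧ Q t s'

theorem WP.mono {c : Prog} {s : Store} {Q Q' : ℕ → Store → Prop} (h : WP c s Q)
    (hQ : ∀ t s', Q t s' → Q' t s') : WP c s Q' := by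
  obtain ⟨t, s', he, hq⟩ := h
  exact ⟨t, s', he, hQ _ _ hq⟩

theorem wp_skip {s : Store} {Q : ℕ → Store → Prop} : WP .skip s Q ↔ Q 1 s := by
  constructor
  · rintro ⟨t, s', he, hq⟩
    cases he
    exact hq
  · exact fun h => ⟨_, _, .skip s, h⟩

theorem wp_setI {s : Store} {Q : ℕ → Store → Prop} {a : ℕ} {i e : IExp} :
    WP (.setI a i e) s Q ↔ Q (i.cost + e.cost + 1) (s.writeI a (i.eval s) (e.eval s)) := by
  constructor
  · rintro ⟨t, s', he, hq⟩
    cases he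
    exact hq
  · exact fun h => ⟨_, _, .setI s a i e, h⟩

theorem wp_setR {s : Store} {Q : ℕ → Store → Prop} {a : ℕ} {i : IExp} {e : RExp} :
    WP (.setR a i e) s Q ↔ Q (i.cost + e.cost + 1) (s.writeR a (i.eval s) (e.eval s)) := by
  constructor
  · rintro ⟨t, s', he, hq⟩
    cases he
    exact hq
  · exact fun h => ⟨_, _, .setR s a i e, h⟩

theorem wp_seq {s : Store} {Q : ℕ → Store → Prop} {c₁ c₂ : Prog} :
    WP (.seq c₁ c₂) s Q ↔ WP c₁ s fun t₁ s₁ => WP c₂ s₁ fun t₂ s₂ => Q (t₁ + t₂) s₂ := by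
  constructor
  · rintro ⟨t, s', he, hq⟩
    cases he with
    | seq h₁ h₂ => exact ⟨_, _, h₁, _, _, h₂, hq⟩
  · rintro ⟨t₁, s₁, h₁, t₂, s₂, h₂, hq⟩
    exact ⟨_, _, .seq h₁ h₂, hq⟩

theorem wp_branch {s : Store} {Q : ℕ → Store → Prop} {b : Test} {c₁ c₂ : Prog} :
    WP (.branch b c₁ c₂) s Q ↔
      (b.Holds s → WP c₁ s fun t s' => Q (b.cost + 1 + t) s') ∧
      (¬ b.Holds s → WP c₂ s fun t s' => Q (b.cost + 1 + t) s') := by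
  constructor
  · rintro ⟨t, s', he, hq⟩
    cases he with
    | branch_true hb h => exact ⟨fun _ => ⟨_, _, h, hq⟩, fun h' => absurd hb h'⟩
    | branch_false hb h => exact ⟨fun h' => absurd h' hb, fun _ => ⟨_, _, h, hq⟩⟩
  · rintro ⟨h₁, h₂⟩
    by_cases hb : b.Holds s
    · obtain ⟨t, s', h, hq⟩ := h₁ hb
      exact ⟨_, _, .branch_true hb h, hq⟩
    · obtain ⟨t, s', h, hq⟩ := h₂ hb
      exact ⟨_, _, .branch_false hb h, hq⟩

/-- Loop rule: the index `k` of the invariant `I` bounds the remaining work, in units of `C`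
steps. -/
theorem wp_loop {b : Test} {c : Prog} {Q : Store → Prop} (C : ℕ) (I : ℕ → Store → Prop)
    (hstep : ∀ k s, I k s → b.Holds s →
      WP c s fun t s' => ∃ k', b.cost + 1 + t + C * k' ≤ C * k ∧ I k' s')
    (hdone : ∀ k s, I k s → ¬ b.Holds s → Q s) (k : ℕ) (s : Store) (hI : I k s) :
    WP (.loop b c) s fun t s' => t ≤ C * k + (b.cost + 1) ∧ Q s' := by
  -- Every iteration costs at least one step, so the potential `C * k` drops strictly. Termination
  -- thus comes for free with the time bound.
  induction hm : C * k using Nat.strong_induction_on generalizing k s with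
  | _ m ih =>
    subst hm
    by_cases hb : b.Holds s
    · obtain ⟨t, s₁, h₁, k', hk', hI'⟩ := hstep k s hI hb
      obtain ⟨t₂, s₂, h₂, ht₂, hQ⟩ := ih (C * k') (by omega) k' s₁ hI' rfl
      exact ⟨_, _, .loop_step hb h₁ h₂, by omega, hQ⟩
    · exact ⟨_, _, .loop_done hb, by omega, hdone k s hI hb⟩

@[simp] theorem writeI_real (s : Store) (a i k : ℕ) : (s.writeI a i k).real = s.real := rfl

@[simp] theorem writeR_int (s : Store) (a i : ℕ) (x : ℝ) : (s.writeR a i x).int = s.int := rfl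

@[simp] theorem writeI_int (s : Store) (a i k b : ℕ) : (s.writeI a i k).int b =
    if b = a then Function.update (s.int b) i k else s.int b := by
  unfold Store.writeI
  by_cases h : b = a
  · subst h; simp
  · simp [h]

@[simp] theorem writeR_real (s : Store) (a i : ℕ) (x : ℝ) (b : ℕ) : (s.writeR a i x).real b =
    if b = a then Function.update (s.real b) i x else s.real b := by
  unfold Store.writeR
  by_cases h : b = a
  · subst h; simp
  · simp [h]

/-- The states `s` and `s'` differ at most in the integer arrays `A` and the real arrays `B`. -/
def Frame (A B : List ℕ) (s s' : Store) : Prop :=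
  (∀ a, a ∉ A → s'.int a = s.int a) ∧ ∀ b, b ∉ B → s'.real b = s.real b

theorem Frame.refl (A B : List ℕ) (s : Store) : Frame A B s s := ⟨fun _ _ => rfl, fun _ _ => rfl⟩

theorem Frame.trans {A B : List ℕ} {s s' s'' : Store} (h : Frame A B s s') (h' : Frame A B s' s'') :
    Frame A B s s'' :=
  ⟨fun a ha => (h'.1 a ha).trans (h.1 a ha), fun b hb => (h'.2 b hb).trans (h.2 b hb)⟩

theorem Frame.mono {A B A' B' : List ℕ} {s s' : Store} (h : Frame A B s s') (hA : A ⊆ A')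
    (hB : B ⊆ B') : Frame A' B' s s' :=
  ⟨fun a ha => h.1 a fun h' => ha (hA h'), fun b hb => h.2 b fun h' => hb (hB h')⟩

theorem Frame.writeI {A B : List ℕ} {s s' : Store} (h : Frame A B s s') {a : ℕ} (ha : a ∈ A)
    (i k : ℕ) : Frame A B s (s'.writeI a i k) := by
  refine ⟨fun b hb => ?_, h.2⟩
  have : b ≠ a := fun e => hb (e ▸ ha)
  simp [this, h.1 b hb]

theorem Frame.writeR {A B : List ℕ} {s s' : Store} (h : Frame A B s s') {a : ℕ} (ha : a ∈ B)
    (i : ℕ) (x : ℝ) : Frame A B s (s'.writeR a i x) := by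
  refine ⟨h.1, fun b hb => ?_⟩
  have : b ≠ a := fun e => hb (e ▸ ha)
  simp [this, h.2 b hb]

/-- The `k`-th cell of the integer array `a`. -/
abbrev ivar (a k : ℕ) : IExp := .get a (.const k)

/-- The `k`-th cell of the real array `a`. -/
abbrev rvar (a k : ℕ) : RExp := .get a (.const k)

/-- The test `x < y` for integers. -/
abbrev ilt (x y : IExp) : Test := .not (.ile y x)

/-- The test `x < y` for reals. -/
abbrev rlt (x y : RExp) : Test := .not (.rle y x)

/-! ### Array segments as lists -/

/-- The sequence of the values of `f` at `i, …, j - 1`. -/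
def seg {α : Type*} (f : ℕ → α) (i j : ℕ) : List α := (List.range' i (j - i)).map f

section seg
variable {α : Type*} {f g : ℕ → α} {i j k : ℕ}

theorem seg_of_le (h : j ≤ i) : seg f i j = [] := by
  simp [seg, Nat.sub_eq_zero_of_le h]

theorem seg_cons (h : i < j) : seg f i j = f i :: seg f (i + 1) j := by
  obtain ⟨m, rfl⟩ := Nat.exists_eq_add_of_lt h
  simp [seg, show i + m + 1 - i = m + 1 by omega, show i + m + 1 - (i + 1) = m by omega,
    List.range'_succ]

theorem seg_append (h : i ≤ j) (h' : j ≤ k) : seg f i j ++ seg f j k = seg f i k := by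
  obtain ⟨m, rfl⟩ := Nat.exists_eq_add_of_le h
  obtain ⟨l, rfl⟩ := Nat.exists_eq_add_of_le h'
  simp only [seg, ← List.map_append]
  rw [show i + m - i = m by omega, show i + m + l - (i + m) = l by omega,
    show i + m + l - i = m + l by omega, ← List.range'_append]
  simp

theorem seg_concat (h : i ≤ j) : seg f i (j + 1) = seg f i j ++ [f j] := by
  rw [← seg_append h (Nat.le_succ j), seg_cons (Nat.lt_succ_self j), seg_of_le (le_refl _)]

theorem seg_congr (h : ∀ m, i ≤ m → m < j → f m = g m) : seg f i j = seg g i j := by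
  refine List.map_congr_left fun m hm => ?_
  rw [List.mem_range'_1] at hm
  exact h m hm.1 (by omega)

theorem mem_seg {x : α} : x ∈ seg f i j ↔ ∃ m, i ≤ m ∧ m < j ∧ f m = x := by
  simp only [seg, List.mem_map, List.mem_range'_1]
  constructor
  · rintro ⟨m, hm, rfl⟩
    exact ⟨m, hm.1, by omega, rfl⟩
  · rintro ⟨m, h₁, h₂, rfl⟩
    exact ⟨m, ⟨h₁, by omega⟩, rfl⟩

theorem pairwise_seg {r : α → α → Prop} :
    (seg f i j).Pairwise r ↔ ∀ m l, i ≤ m → m < l → l < j → r (f m) (f l) := by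
  induction hd : j - i generalizing i with
  | zero =>
    rw [seg_of_le (by omega)]
    exact ⟨fun _ m l _ _ _ => by omega, fun _ => .nil⟩
  | succ d ih =>
    rw [seg_cons (by omega), List.pairwise_cons, ih (by omega)]
    constructor
    · rintro ⟨h₁, h₂⟩ m l hm hml hl
      rcases Nat.eq_or_lt_of_le hm with rfl | hm
      · exact h₁ _ (mem_seg.2 ⟨l, by omega, hl, rfl⟩)
      · exact h₂ m l hm hml hl
    · intro h
      refine ⟨fun x hx => ?_, fun m l hm hml hl => h m l (by omega) hml hl⟩
      obtain ⟨l, h₁, h₂, rfl⟩ := mem_seg.1 hx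
      exact h i l le_rfl h₁ h₂

/-- Turns counts that are invariant under permutation of lists into cardinalities of index sets;
used to compare the gaps with the sorted gaps. -/
theorem countP_seg_zero (p : α → Bool) (n : ℕ) :
    (seg f 0 n).countP p = ((Finset.range n).filter fun m => p (f m)).card := by
  induction n with
  | zero => simp [seg]
  | succ n ih =>
    rw [seg_concat (Nat.zero_le _), List.countP_append, ih, Finset.range_add_one,
      Finset.filter_insert]
    by_cases h : p (f n) <;> simp [h]

end seg

end RealRAM

/-! ### Bottom-up merge sort -/

namespace RealRAM

/-- Merging of sorted lists of real numbers. -/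
noncomputable abbrev rmerge (l l' : List ℝ) : List ℝ := l.merge l' fun x y => decide (x ≤ y)

/-- One step of merging the cells `mid, …, hi - 1` of the real array `X` to those before `mid`. The
result goes to the real array `9`; cells `2, …, 6` of the integer array `3` hold `mid`, `hi`, the
two reading positions, and the writing position. -/
def mergeStep (X : ℕ) : Prog :=
  .seq
    (.branch (.and (ilt (ivar 3 4) (ivar 3 2))
        (.not (.and (ilt (ivar 3 5) (ivar 3 3)) (rlt (.get X (ivar 3 5)) (.get X (ivar 3 4))))))
      (.seq (.setR 9 (ivar 3 6) (.get X (ivar 3 4))) (.setI 3 (.const 4) (.add (ivar 3 4) (.const 1))))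
      (.seq (.setR 9 (ivar 3 6) (.get X (ivar 3 5))) (.setI 3 (.const 5) (.add (ivar 3 5) (.const 1)))))
    (.setI 3 (.const 6) (.add (ivar 3 6) (.const 1)))

/-- Merging of two adjacent segments of the real array `X` into the real array `9`. -/
def mergeLoop (X : ℕ) : Prog := .loop (ilt (ivar 3 6) (ivar 3 3)) (mergeStep X)

/-- The invariant of `mergeLoop`. -/
structure MergeInv (X : ℕ) (s₀ : Store) (lo mid hi : ℕ) (r : ℕ) (s : Store) : Prop where
  frame : Frame [3] [9] s₀ s
  loc : ∀ c < 4, s.int 3 c = s₀.int 3 c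
  h_mid : s.int 3 2 = mid
  h_hi : s.int 3 3 = hi
  le_i : lo ≤ s.int 3 4
  i_le : s.int 3 4 ≤ mid
  mid_le : mid ≤ s.int 3 5
  j_le : s.int 3 5 ≤ hi
  pos : s.int 3 6 + mid = s.int 3 4 + s.int 3 5
  left : r + s.int 3 6 = hi
  below : ∀ m < lo, s.real 9 m = s₀.real 9 m
  merged : seg (s.real 9) lo (s.int 3 6) ++
      rmerge (seg (s₀.real X) (s.int 3 4) mid) (seg (s₀.real X) (s.int 3 5) hi) =
    rmerge (seg (s₀.real X) lo mid) (seg (s₀.real X) mid hi)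

theorem rmerge_take_left {f : ℕ → ℝ} {i mid j hi : ℕ} (hi' : i < mid)
    (h : ¬ (j < hi ∧ f j < f i)) :
    rmerge (seg f i mid) (seg f j hi) = f i :: rmerge (seg f (i + 1) mid) (seg f j hi) := by
  rw [seg_cons hi']
  rcases lt_or_ge j hi with hj | hj
  · rw [seg_cons hj]
    refine List.cons_merge_cons_pos _ _ _ ?_
    simpa using fun h' : f j < f i => h ⟨hj, h'⟩
  · rw [seg_of_le hj]
    simp

theorem rmerge_take_right {f : ℕ → ℝ} {i mid j hi : ℕ} (hj : j < hi)
    (h : i < mid → f j < f i) :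
    rmerge (seg f i mid) (seg f j hi) = f j :: rmerge (seg f i mid) (seg f (j + 1) hi) := by
  rcases lt_or_ge i mid with hi' | hi'
  · rw [seg_cons hj, seg_cons hi']
    refine List.cons_merge_cons_neg _ _ _ ?_
    simpa using h hi'
  · rw [seg_of_le hi', seg_cons hj]
    simp

/-- The summand `6` is the cost of the guard of the enclosing loop and `1` that of the loop step.
One unit of the potential pays `50` steps per written cell. The other loop bodies are accounted for
in the same way. -/
theorem wp_mergeStep {X : ℕ} (hX : X ≠ 9) {s₀ s : Store} {lo mid hi r : ℕ}
    (h : MergeInv X s₀ lo mid hi r s) (hr : s.int 3 6 < s.int 3 3) :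
    WP (mergeStep X) s fun t s' => ∃ r', 6 + 1 + t + 50 * r' ≤ 50 * r ∧
      MergeInv X s₀ lo mid hi r' s' := by
  obtain ⟨frame, loc, h_mid, h_hi, le_i, i_le, mid_le, j_le, pos, left, below, merged⟩ := h
  have hXr : s.real X = s₀.real X := frame.2 X (by simp [hX])
  simp only [mergeStep, wp_seq, wp_branch, wp_setI, wp_setR, IExp.eval, RExp.eval, Test.Holds,
    IExp.cost, RExp.cost, Test.cost, not_le]
  refine ⟨fun ⟨hlt, hc⟩ => ⟨r - 1, by omega, ?_⟩, fun hn => ⟨r - 1, by omega, ?_⟩⟩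
  · rw [h_mid] at hlt
    have key := rmerge_take_left (f := s₀.real X) (j := s.int 3 5) (hi := hi) hlt
      (by rw [← hXr, ← h_hi]; exact hc)
    refine ⟨((frame.writeR (by simp) _ _).writeI (by simp) _ _).writeI (by simp) _ _,
      fun c hc => ?_, ?_, ?_, ?_, ?_, ?_, ?_, ?_, ?_, fun m hm => ?_, ?_⟩
    · have h4 : c ≠ 4 := by omega
      have h6 : c ≠ 6 := by omega
      simp [loc c hc, h4, h6]
    all_goals simp
    any_goals omega
    · rw [Function.update_of_ne (by omega), below m hm]
    · rw [seg_concat (by omega), List.append_assoc]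
      rw [key] at merged
      rw [← merged, seg_congr (g := s.real 9)]
      · simp [hXr]
      · intro m _ hm
        rw [Function.update_of_ne (by omega)]
  · have hj : s.int 3 5 < hi := by
      -- If the right segment were exhausted, `pos` would leave an unread cell in the left one, and
      -- the test would have succeeded.
      by_contra hcon
      exact hn ⟨by omega, fun hh => by omega⟩
    have key := rmerge_take_right (f := s₀.real X) (i := s.int 3 4) (mid := mid) hj
      (by
        intro hlt
        rw [← hXr]
        by_contra hcon
        exact hn ⟨by omega, fun hh => hcon hh.2⟩)
    refine ⟨((frame.writeR (by simp) _ _).writeI (by simp) _ _).writeI (by simp) _ _,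
      fun c hc => ?_, ?_, ?_, ?_, ?_, ?_, ?_, ?_, ?_, fun m hm => ?_, ?_⟩
    · have h4 : c ≠ 5 := by omega
      have h6 : c ≠ 6 := by omega
      simp [loc c hc, h4, h6]
    all_goals simp
    any_goals omega
    · rw [Function.update_of_ne (by omega), below m hm]
    · rw [seg_concat (by omega), List.append_assoc]
      rw [key] at merged
      rw [← merged, seg_congr (g := s.real 9)]
      · simp [hXr]
      · intro m _ hm
        rw [Function.update_of_ne (by omega)]

theorem wp_mergeLoop {X : ℕ} (hX : X ≠ 9) {s : Store} {lo mid hi : ℕ} (h_mid : s.int 3 2 = mid)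
    (h_hi : s.int 3 3 = hi) (h_i : s.int 3 4 = lo) (h_j : s.int 3 5 = mid) (h_k : s.int 3 6 = lo)
    (hlm : lo ≤ mid) (hmh : mid ≤ hi) :
    WP (mergeLoop X) s fun t s' => t ≤ 50 * (hi - lo) + 7 ∧
      Frame [3] [9] s s' ∧ (∀ c < 4, s'.int 3 c = s.int 3 c) ∧
      (∀ m < lo, s'.real 9 m = s.real 9 m) ∧
      seg (s'.real 9) lo hi = rmerge (seg (s.real X) lo mid) (seg (s.real X) mid hi) := by
  refine wp_loop 50 (MergeInv X s lo mid hi) (fun r s' h hb => ?_) (fun r s' h hb => ?_)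
    (hi - lo) s ?_
  · simp only [Test.Holds, IExp.eval, not_le] at hb
    exact wp_mergeStep hX h hb
  · simp only [Test.Holds, IExp.eval, not_le] at hb
    obtain ⟨frame, loc, h_mid, h_hi, le_i, i_le, mid_le, j_le, pos, left, below, merged⟩ := h
    refine ⟨frame, loc, below, ?_⟩
    rw [← merged, seg_of_le (i := s'.int 3 4) (by omega), seg_of_le (i := s'.int 3 5) (by omega),
      show s'.int 3 6 = hi by omega]
    simp
  · refine ⟨.refl _ _ _, fun _ _ => rfl, h_mid, h_hi, ?_, ?_, ?_, ?_, ?_, ?_, fun _ _ => rfl, ?_⟩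
    any_goals omega
    rw [h_k, h_i, h_j, seg_of_le le_rfl]
    simp

/-- Every block `f (m * W), …, f ((m + 1) * W - 1)`, cut off at `n`, is sorted. -/
def BlockSorted (W n : ℕ) (f : ℕ → ℝ) : Prop :=
  ∀ m, (seg f (min (m * W) n) (min ((m + 1) * W) n)).Pairwise (· ≤ ·)

/-- Merging of the next two blocks of length `W`, with `W` in cell `0` and the start of the blocks
in cell `1` of the integer array `3`. -/
def passStep (X : ℕ) : Prog :=
  .seq (.setI 3 (.const 2) (.sub (ivar 0 0) (.sub (ivar 0 0) (.add (ivar 3 1) (ivar 3 0)))))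
  (.seq (.setI 3 (.const 3)
    (.sub (ivar 0 0) (.sub (ivar 0 0) (.add (ivar 3 1) (.add (ivar 3 0) (ivar 3 0))))))
  (.seq (.setI 3 (.const 4) (ivar 3 1))
  (.seq (.setI 3 (.const 5) (ivar 3 2))
  (.seq (.setI 3 (.const 6) (ivar 3 1))
  (.seq (mergeLoop X)
  (.setI 3 (.const 1) (ivar 3 3)))))))

/-- Merging of all pairs of blocks of length `W`. -/
def passLoop (X : ℕ) : Prog := .loop (ilt (ivar 3 1) (ivar 0 0)) (passStep X)

/-- The invariant of `passLoop`. -/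
structure PassInv (X : ℕ) (s₀ : Store) (n W : ℕ) (r : ℕ) (s : Store) : Prop where
  frame : Frame [3] [9] s₀ s
  width : s.int 3 0 = W
  left : r + s.int 3 1 = n
  blocks : ∃ l, s.int 3 1 = min (l * (2 * W)) n ∧ ∀ m < l,
    (seg (s.real 9) (min (m * (2 * W)) n) (min ((m + 1) * (2 * W)) n)).Pairwise (· ≤ ·)
  perm : (seg (s.real 9) 0 (s.int 3 1)).Perm (seg (s₀.real X) 0 (s.int 3 1))

theorem wp_passStep {X : ℕ} (hX : X ≠ 9) {s₀ s : Store} {n W r : ℕ} (hn : s₀.int 0 0 = n)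
    (hW : 0 < W) (hB : BlockSorted W n (s₀.real X)) (h : PassInv X s₀ n W r s)
    (hr : s.int 3 1 < n) :
    WP (passStep X) s fun t s' => ∃ r', 6 + 1 + t + 150 * r' ≤ 150 * r ∧
      PassInv X s₀ n W r' s' := by
  obtain ⟨frame, width, left, ⟨l, hl, blocks⟩, perm⟩ := h
  have hXr : s.real X = s₀.real X := frame.2 X (by simp [hX])
  have hn' : s.int 0 0 = n := (by rw [frame.1 0 (by simp), hn])
  have hlo : s.int 3 1 = l * (2 * W) := by omega
  simp only [passStep, wp_seq, wp_setI, IExp.eval, IExp.cost]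
  -- The machine computes these minima as `n - (n - x)` with truncated subtraction; this cuts off
  -- the last blocks at `n`.
  refine (wp_mergeLoop hX (lo := s.int 3 1) (mid := min (s.int 3 1 + W) n)
    (hi := min (s.int 3 1 + 2 * W) n) ?_ ?_ ?_ ?_ ?_ ?_ ?_).mono ?_
  any_goals simp [hn', width]
  any_goals omega
  rintro t s' ht frame' loc below hm
  have e0 := loc 0 (by omega)
  have e1 := loc 1 (by omega)
  have e3 := loc 3 (by omega)
  simp [width] at e0 e1 e3
  replace e3 : s'.int 3 3 = min (s.int 3 1 + 2 * W) n := by omega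
  have hs1 : min ((2 * l) * W) n = s.int 3 1 := by rw [hl]; congr 1; ring
  have hs2 : min ((2 * l + 1) * W) n = min (s.int 3 1 + W) n := by rw [hlo]; congr 1; ring
  have hs3 : min ((2 * l + 1 + 1) * W) n = min (s.int 3 1 + 2 * W) n := by rw [hlo]; congr 1; ring
  have hs4 : min ((l + 1) * (2 * W)) n = min (s.int 3 1 + 2 * W) n := by rw [hlo]; congr 1; ring
  have b1 := hB (2 * l)
  have b2 := hB (2 * l + 1)
  rw [hs1, hs2] at b1
  rw [hs2, hs3] at b2
  rw [hXr] at hm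
  refine ⟨n - min (s.int 3 1 + 2 * W) n, by omega, ?_, ?_, ?_, ⟨l + 1, ?_, fun m hml => ?_⟩, ?_⟩
  · refine Frame.writeI ?_ (by simp) _ _
    refine Frame.trans ?_ frame'
    exact ((((frame.writeI (by simp) _ _).writeI (by simp) _ _).writeI (by simp) _ _).writeI
      (by simp) _ _).writeI (by simp) _ _
  · simpa using e0
  · simp
    omega
  · simp
    omega
  · simp only [writeI_real]
    rcases Nat.lt_succ_iff_lt_or_eq.1 hml with hml | rfl
    · have : (m + 1) * (2 * W) ≤ l * (2 * W) := Nat.mul_le_mul_right _ hml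
      rw [seg_congr (g := s.real 9)]
      · exact blocks m hml
      · intro c _ hc
        exact below c (by omega)
    · rw [hs4, ← hl, hm]
      exact List.Pairwise.merge b1 b2
  · simp only [writeI_real, writeI_int, if_true, Function.update_self, e3]
    rw [← seg_append (i := 0) (j := s.int 3 1) (k := min (s.int 3 1 + 2 * W) n) (Nat.zero_le _)
      (by omega), hm, ← seg_append (i := 0) (j := s.int 3 1) (k := min (s.int 3 1 + 2 * W) n)
      (Nat.zero_le _) (by omega), seg_congr (g := s.real 9) (fun c _ hc => below c hc)]
    refine perm.append ?_
    rw [← seg_append (i := s.int 3 1) (j := min (s.int 3 1 + W) n)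
      (k := min (s.int 3 1 + 2 * W) n) (by omega) (by omega)]
    exact List.merge_perm_append _

theorem wp_passLoop {X : ℕ} (hX : X ≠ 9) {s : Store} {n W : ℕ} (hn : s.int 0 0 = n)
    (hW : 0 < W) (hB : BlockSorted W n (s.real X)) (h0 : s.int 3 0 = W) (h1 : s.int 3 1 = 0) :
    WP (passLoop X) s fun t s' => t ≤ 150 * n + 7 ∧ Frame [3] [9] s s' ∧ s'.int 3 0 = W ∧
      BlockSorted (2 * W) n (s'.real 9) ∧ (seg (s'.real 9) 0 n).Perm (seg (s.real X) 0 n) := by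
  refine wp_loop 150 (PassInv X s n W) (fun r s' h hb => ?_) (fun r s' h hb => ?_) n s ?_
  · simp only [Test.Holds, IExp.eval, not_le, h.frame.1 0 (by simp), hn] at hb
    exact wp_passStep hX hn hW hB h hb
  · simp only [Test.Holds, IExp.eval, not_le, h.frame.1 0 (by simp), hn] at hb
    obtain ⟨frame, width, left, ⟨l, hl, blocks⟩, perm⟩ := h
    have hl' : s'.int 3 1 = n := by omega
    rw [hl'] at perm
    refine ⟨frame, width, fun m => ?_, perm⟩
    rcases lt_or_ge m l with hml | hml
    · exact blocks m hml
    · have : l * (2 * W) ≤ m * (2 * W) := Nat.mul_le_mul_right _ hml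
      rw [seg_of_le (by omega)]
      exact .nil
  · refine ⟨.refl _ _ _, h0, by omega, ⟨0, by simp [h1], fun m hm => by omega⟩, ?_⟩
    rw [h1]
    exact .refl _

/-- Copying of the cells `0, …, n - 1` of the real array `9` to `X`. -/
def copyLoop (X : ℕ) : Prog :=
  .loop (ilt (ivar 3 7) (ivar 0 0))
    (.seq (.setR X (ivar 3 7) (.get 9 (ivar 3 7)))
      (.setI 3 (.const 7) (.add (ivar 3 7) (.const 1))))

theorem wp_copyLoop {X : ℕ} (hX : X ≠ 9) {s : Store} {n : ℕ} (hn : s.int 0 0 = n)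
    (h7 : s.int 3 7 = 0) :
    WP (copyLoop X) s fun t s' => t ≤ 30 * n + 7 ∧ Frame [3] [X] s s' ∧ s'.int 3 0 = s.int 3 0 ∧
      ∀ m < n, s'.real X m = s.real 9 m := by
  refine wp_loop 30 (fun r s' => Frame [3] [X] s s' ∧ s'.int 3 0 = s.int 3 0 ∧
    r + s'.int 3 7 = n ∧ ∀ m < s'.int 3 7, s'.real X m = s.real 9 m) ?_ ?_ n s ?_
  · rintro r s' ⟨frame, h0, left, hc⟩ hb
    simp only [Test.Holds, IExp.eval, not_le, frame.1 0 (by simp), hn] at hb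
    simp only [wp_seq, wp_setI, wp_setR, IExp.eval, IExp.cost, RExp.eval, RExp.cost, Test.cost]
    refine ⟨r - 1, by omega, (frame.writeR (by simp) _ _).writeI (by simp) _ _, ?_, ?_, ?_⟩
    · simpa using h0
    · simp
      omega
    · simp only [writeI_real, writeI_int, writeR_int, writeR_real, if_true, Function.update_self]
      intro m hm
      rcases Nat.lt_succ_iff_lt_or_eq.1 hm with hm | rfl
      · rw [Function.update_of_ne (by omega), hc m hm]
      · rw [Function.update_self, frame.2 9 (by simp [hX.symm])]
  · rintro r s' ⟨frame, h0, left, hc⟩ hb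
    simp only [Test.Holds, IExp.eval, not_le, frame.1 0 (by simp), hn] at hb
    exact ⟨frame, h0, fun m hm => hc m (by omega)⟩
  · exact ⟨.refl _ _ _, rfl, by omega, fun m hm => by omega⟩

/-- One round of bottom-up merge sort: the block length is doubled. -/
def sortStep (X : ℕ) : Prog :=
  .seq (.setI 3 (.const 1) (.const 0))
  (.seq (passLoop X)
  (.seq (.setI 3 (.const 7) (.const 0))
  (.seq (copyLoop X)
  (.setI 3 (.const 0) (.add (ivar 3 0) (ivar 3 0))))))

/-- Bottom-up merge sort of the cells `0, …, n - 1` of the real array `X`, where `n` is in cell `0`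
of the integer array `0`. -/
def sortProg (X : ℕ) : Prog :=
  .seq (.setI 3 (.const 0) (.const 1)) (.loop (ilt (ivar 3 0) (ivar 0 0)) (sortStep X))

/-- The invariant of the loop of `sortProg`. -/
structure SortInv (X : ℕ) (s₀ : Store) (n : ℕ) (r : ℕ) (s : Store) : Prop where
  frame : Frame [3] [X, 9] s₀ s
  width : ∃ e, s.int 3 0 = 2 ^ e ∧ r + e = Nat.clog 2 n
  blocks : BlockSorted (s.int 3 0) n (s.real X)
  perm : (seg (s.real X) 0 n).Perm (seg (s₀.real X) 0 n)

theorem wp_sortStep {X : ℕ} (hX : X ≠ 9) {s₀ s : Store} {n r : ℕ} (hn : s₀.int 0 0 = n)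
    (h : SortInv X s₀ n r s) (hr : s.int 3 0 < n) :
    WP (sortStep X) s fun t s' => ∃ r', 6 + 1 + t + (180 * n + 50) * r' ≤ (180 * n + 50) * r ∧
      SortInv X s₀ n r' s' := by
  obtain ⟨frame, ⟨e, hW, he⟩, blocks, perm⟩ := h
  -- The block length is `2 ^ e`, and a length below `n` means that a doubling is still paid for.
  have hr0 : e < Nat.clog 2 n := (Nat.lt_clog_iff_pow_lt one_lt_two).2 (hW ▸ hr)
  have hn' : s.int 0 0 = n := (by rw [frame.1 0 (by simp), hn])
  simp only [sortStep, wp_seq, wp_setI, IExp.eval, IExp.cost]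
  refine (wp_passLoop hX (n := n) (W := s.int 3 0) ?_ ?_ ?_ ?_ ?_).mono ?_
  · simpa using hn'
  · rw [hW]; positivity
  · simpa using blocks
  · simp
  · simp
  rintro t s₁ ⟨ht, frame₁, w₁, b₁, p₁⟩
  have n₁ : s₁.int 0 0 = n := by rw [frame₁.1 0 (by simp)]; simpa using hn'
  refine (wp_copyLoop hX (n := n) (by simpa using n₁) (by simp)).mono ?_
  rintro t' s₂ ⟨ht', frame₂, w₂, c₂⟩
  simp at w₂ c₂ p₁
  rw [w₁] at w₂
  have hc : ∀ i j, j ≤ n → seg (s₂.real X) i j = seg (s₁.real 9) i j :=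
    fun i j hj => seg_congr fun m _ hm => c₂ m (by omega)
  refine ⟨r - 1, ?_, ?_, ⟨e + 1, ?_, by omega⟩, ?_, ?_⟩
  · obtain ⟨r, rfl⟩ : ∃ r', r = r' + 1 := ⟨r - 1, by omega⟩
    simp only [Nat.add_sub_cancel, Nat.mul_add]
    omega
  · refine Frame.writeI ?_ (by simp) _ _
    refine (frame.writeI (by simp) _ _).trans (.trans (frame₁.mono (by simp) (by simp)) ?_)
    exact ((Frame.refl _ _ s₁).writeI (by simp) _ _).trans (frame₂.mono (by simp) (by simp))
  · simp [w₂, hW, pow_succ, mul_two]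
  · simp only [writeI_real, writeI_int, if_true, Function.update_self, w₂, ← two_mul]
    intro m
    rw [hc _ _ (by omega)]
    exact b₁ m
  · simp only [writeI_real]
    rw [hc _ _ le_rfl]
    exact p₁.trans perm

theorem wp_sortProg {X : ℕ} (hX : X ≠ 9) {s : Store} {n : ℕ} (hn : s.int 0 0 = n) :
    WP (sortProg X) s fun t s' => t ≤ (180 * n + 50) * Nat.clog 2 n + 10 ∧ Frame [3] [X, 9] s s' ∧
      (seg (s'.real X) 0 n).Pairwise (· ≤ ·) ∧ (seg (s'.real X) 0 n).Perm (seg (s.real X) 0 n) := by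
  simp only [sortProg, wp_seq, wp_setI, IExp.eval, IExp.cost]
  refine (wp_loop (180 * n + 50) (SortInv X s n) (fun r s' h hb => ?_) (fun r s' h hb => ?_)
    (Q := fun s' => Frame [3] [X, 9] s s' ∧ (seg (s'.real X) 0 n).Pairwise (· ≤ ·) ∧
      (seg (s'.real X) 0 n).Perm (seg (s.real X) 0 n)) (Nat.clog 2 n) _ ?_).mono ?_
  · simp only [Test.Holds, IExp.eval, not_le, h.frame.1 0 (by simp), hn] at hb
    exact wp_sortStep hX hn h hb
  · simp only [Test.Holds, IExp.eval, not_le, h.frame.1 0 (by simp), hn, not_lt] at hb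
    refine ⟨h.frame, ?_, h.perm⟩
    -- The block length has reached `n`, so block `0` is the whole array.
    have := h.blocks 0
    rwa [show min (0 * s'.int 3 0) n = 0 by simp, show min ((0 + 1) * s'.int 3 0) n = n by
      simpa using hb] at this
  · refine ⟨(Frame.refl _ _ s).writeI (by simp) _ _, ⟨0, by simp, by simp⟩, ?_, .refl _⟩
    intro m
    rw [pairwise_seg]
    simp
    omega
  · rintro t s' ⟨ht, h⟩
    simp only [Test.cost, IExp.cost] at ht
    exact ⟨by omega, h⟩

end RealRAM

/-! ### Coverings of numbers by intervals -/

namespace RedBlue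

open RealRAM

/-- The numbers `T 0, …, T (n - 1)` are covered by `k` intervals of radius `ρ`. -/
def Coverable (T : ℕ → ℝ) (n k : ℕ) (ρ : ℝ) : Prop :=
  ∃ c : Fin k → ℝ, ∀ i < n, ∃ j, |T i - c j| ≤ ρ

/-- The distance from `T i` to `T (i + 1)`, and `0` for the last index. -/
noncomputable def gap (T : ℕ → ℝ) (n i : ℕ) : ℝ := if i + 1 < n then T (i + 1) - T i else 0

/-- The indices `J 0 < … < J (m - 1)` start intervals of length `w` that cover `T 0, …, T (n - 1)`
and whose left ends are more than `w` apart. -/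
structure Starts (T : ℕ → ℝ) (n : ℕ) (w : ℝ) (J : ℕ → ℕ) (m : ℕ) : Prop where
  pos : 0 < m
  lt : ∀ j < m, J j < n
  succ_lt : ∀ j, j + 1 < m → J j < J (j + 1)
  apart : ∀ j, j + 1 < m → T (J j) + w < T (J (j + 1))
  cover : ∀ i < n, ∃ j < m, T (J j) ≤ T i ∧ T i ≤ T (J j) + w

/-- Pigeonhole: two of the more than `k` chosen numbers lie in the same interval of radius `ρ`,
hence are at most `2 * ρ` apart. -/
theorem lt_two_mul_of_coverable {T : ℕ → ℝ} {n k : ℕ} {ρ w : ℝ} (h : Coverable T n k ρ)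
    {D : Finset ℕ} (hD : ∀ i ∈ D, i < n) (hk : k < D.card)
    (hw : ∀ i ∈ D, ∀ j ∈ D, i < j → T i + w < T j) : w < 2 * ρ := by
  obtain ⟨c, hc⟩ := h
  obtain ⟨x₀, hx₀⟩ := Finset.card_pos.1 (Nat.zero_lt_of_lt hk)
  have : Nonempty (Fin k) := ⟨(hc x₀ (hD x₀ hx₀)).choose⟩
  choose! f hf using hc
  have hk' : (Finset.univ : Finset (Fin k)).card < D.card := by simpa using hk
  obtain ⟨x, hx, y, hy, hne, hxy⟩ := Finset.exists_ne_map_eq_of_card_lt_of_maps_to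
    (f := f) hk' (fun _ _ => Finset.mem_coe.2 (Finset.mem_univ _))
  have h1 := abs_le.1 (hf x (hD x hx))
  have h2 := abs_le.1 (hf y (hD y hy))
  rw [hxy] at h1
  rcases lt_or_gt_of_ne hne with hlt | hlt
  · have := hw x hx y hy hlt
    linarith [h1.1, h2.2]
  · have := hw y hy x hx hlt
    linarith [h1.2, h2.1]

section
variable {T : ℕ → ℝ} {n k m : ℕ} {w : ℝ} {J : ℕ → ℕ}

theorem Starts.index_lt (h : Starts T n w J m) {i j : ℕ} (hij : i < j) (hj : j < m) :
    J i < J j := by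
  induction j, hij using Nat.le_induction with
  | base => exact h.succ_lt i hj
  | succ j hij ih => exact (ih (by omega)).trans (h.succ_lt j hj)

theorem Starts.add_lt (h : Starts T n w J m) (hw : 0 ≤ w) {i j : ℕ} (hij : i < j) (hj : j < m) :
    T (J i) + w < T (J j) := by
  induction j, hij using Nat.le_induction with
  | base => exact h.apart i hj
  | succ j hij ih => linarith [ih (by omega), h.apart j hj]

theorem Starts.lt_two_mul (h : Starts T n w J m) (hw : 0 ≤ w) (hk : k < m) {ρ : ℝ}
    (hc : Coverable T n k ρ) : w < 2 * ρ := by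
  have hinj : Set.InjOn J (Finset.range m) := by
    intro i hi j hj hij
    simp only [Finset.coe_range, Set.mem_Iio] at hi hj
    rcases lt_trichotomy i j with h' | h' | h'
    · exact absurd hij (h.index_lt h' hj).ne
    · exact h'
    · exact absurd hij (h.index_lt h' hi).ne'
  refine lt_two_mul_of_coverable hc (D := (Finset.range m).image J) ?_ ?_ ?_
  · simp only [Finset.mem_image, Finset.mem_range]
    rintro _ ⟨j, hj, rfl⟩
    exact h.lt j hj
  · rwa [Finset.card_image_of_injOn hinj, Finset.card_range]
  · simp only [Finset.mem_image, Finset.mem_range]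
    rintro _ ⟨i, hi, rfl⟩ _ ⟨j, hj, rfl⟩ hij
    refine h.add_lt hw ?_ hj
    by_contra hcon
    rcases Nat.eq_or_lt_of_le (not_lt.1 hcon) with rfl | h'
    · exact lt_irrefl _ hij
    · exact lt_asymm hij (h.index_lt h' hi)

theorem sub_le_of_gap_le {a b : ℕ} (hab : a ≤ b) (hb : b < n) {g : ℝ}
    (h : ∀ i, a ≤ i → i < b → gap T n i ≤ g) : T b - T a ≤ (b - a : ℕ) * g := by
  induction b, hab using Nat.le_induction with
  | base => simp
  | succ b hab ih =>
    have h1 := ih (by omega) fun i hi hib => h i hi (by omega)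
    have h2 := h b hab (Nat.lt_succ_self b)
    rw [gap, if_pos hb] at h2
    rw [Nat.succ_sub hab, Nat.cast_succ, add_mul]
    linarith

/-- A jump between consecutive starts exceeds `w ≥ n * g` but is a sum of at most `n` gaps, so one
of these gaps exceeds `g`. Different jumps use disjoint ranges of indices, so there are at least `m
- 1` large gaps. -/
theorem Starts.le_of_gaps (h : Starts T n w J m) {g : ℝ} (hg : 0 ≤ g) (hw : n * g ≤ w)
    (hk : ((Finset.range n).filter fun i => g < gap T n i).card < k) : m ≤ k := by
  have key : ∀ j, j + 1 < m → ∃ i, J j ≤ i ∧ i < J (j + 1) ∧ g < gap T n i := by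
    intro j hj
    by_contra! hcon
    have h1 := sub_le_of_gap_le (h.succ_lt j hj).le (h.lt _ hj) hcon
    have h2 : ((J (j + 1) - J j : ℕ) : ℝ) * g ≤ n * g := by
      refine mul_le_mul_of_nonneg_right ?_ hg
      exact_mod_cast (Nat.sub_le _ _).trans (h.lt _ hj).le
    linarith [h.apart j hj]
  choose! f hf using key
  have hle : (Finset.range (m - 1)).card ≤
      ((Finset.range n).filter fun i => g < gap T n i).card := by
    refine Finset.card_le_card_of_injOn f ?_ ?_
    · intro j hj
      simp only [Finset.coe_range, Set.mem_Iio] at hj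
      obtain ⟨h1, h2, h3⟩ := hf j (by omega)
      simp only [Finset.coe_filter, Finset.mem_range, Set.mem_ofPred_eq]
      exact ⟨h2.trans (h.lt _ (by omega)), h3⟩
    · have hlt : ∀ i j, i < j → j < m - 1 → f i < f j := by
        intro i j hij hj
        refine (hf i (by omega)).2.1.trans_le (le_trans ?_ (hf j (by omega)).1)
        rcases Nat.eq_or_lt_of_le (Nat.succ_le_of_lt hij) with rfl | h'
        · exact le_rfl
        · exact (h.index_lt h' (by omega)).le
      intro i hi j hj hij
      simp only [Finset.coe_range, Set.mem_Iio] at hi hj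
      rcases lt_trichotomy i j with h' | h' | h'
      · exact absurd hij (hlt i j h' hj).ne
      · exact h'
      · exact absurd hij (hlt j i h' hi).ne'
  rw [Finset.card_range] at hle
  omega

theorem le_of_pairwise_seg (hT : (seg T 0 n).Pairwise (· ≤ ·)) {i j : ℕ} (hij : i ≤ j)
    (hj : j < n) : T i ≤ T j := by
  rcases Nat.eq_or_lt_of_le hij with rfl | h
  · exact le_rfl
  · exact pairwise_seg.1 hT i j (Nat.zero_le _) h hj

theorem gap_nonneg (hT : (seg T 0 n).Pairwise (· ≤ ·)) (i : ℕ) : 0 ≤ gap T n i := by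
  unfold gap
  split_ifs with h
  · linarith [le_of_pairwise_seg hT (Nat.le_succ i) h]
  · exact le_rfl

/-- The right ends of the gaps longer than `2 * ρ`, together with the first number, are pairwise
more than `2 * ρ` apart; with `k` such gaps this contradicts the pigeonhole bound. -/
theorem card_gap_lt (hT : (seg T 0 n).Pairwise (· ≤ ·)) {ρ : ℝ} (hρ : 0 ≤ ρ) (hn : 0 < n)
    (hc : Coverable T n k ρ) :
    ((Finset.range n).filter fun i => 2 * ρ < gap T n i).card < k := by
  set S := (Finset.range n).filter fun i => 2 * ρ < gap T n i with hS
  have hmem : ∀ i ∈ S, i + 1 < n ∧ T i + 2 * ρ < T (i + 1) := by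
    intro i hi
    have h1 := (Finset.mem_filter.1 hi).2
    unfold gap at h1
    split_ifs at h1 with h2
    · exact ⟨h2, by linarith⟩
    · linarith
  by_contra! hk
  have hcard : (insert 0 (S.image Nat.succ)).card = S.card + 1 := by
    rw [Finset.card_insert_of_notMem (by simp),
      Finset.card_image_of_injective _ Nat.succ_injective]
  refine lt_irrefl _ (lt_two_mul_of_coverable hc (D := insert 0 (S.image Nat.succ)) ?_
    (by omega) ?_)
  · intro i hi
    rcases Finset.mem_insert.1 hi with rfl | hi
    · exact hn
    · obtain ⟨j, hj, rfl⟩ := Finset.mem_image.1 hi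
      exact (hmem j hj).1
  · intro i _ j hj hij
    rcases Finset.mem_insert.1 hj with rfl | hj
    · omega
    · obtain ⟨j, hjS, rfl⟩ := Finset.mem_image.1 hj
      have := le_of_pairwise_seg hT (i := i) (j := j) (by omega) (by have := (hmem j hjS).1; omega)
      linarith [(hmem j hjS).2]

variable {G : ℕ → ℝ}

theorem card_filter_gap (hG : (seg G 0 n).Perm (seg (gap T n) 0 n)) (g : ℝ) :
    ((Finset.range n).filter fun i => g < gap T n i).card =
      ((Finset.range n).filter fun i => g < G i).card := by
  have := hG.countP_eq (p := fun x => decide (g < x))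
  simpa [countP_seg_zero] using this.symm

/-- Otherwise all entries of `G` from position `n - k` on exceed `2 * ρ`, which for `k ≤ n` are `k`
large gaps. -/
theorem sorted_gap_le (hT : (seg T 0 n).Pairwise (· ≤ ·)) (hG : (seg G 0 n).Pairwise (· ≤ ·))
    (hp : (seg G 0 n).Perm (seg (gap T n) 0 n)) {ρ : ℝ} (hρ : 0 ≤ ρ) (hn : 0 < n)
    (hc : Coverable T n k ρ) : G (n - k) ≤ 2 * ρ := by
  by_contra! hcon
  have h1 := card_gap_lt hT hρ hn hc
  rw [card_filter_gap hp] at h1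
  have h2 : Finset.Ico (n - k) n ⊆ (Finset.range n).filter fun i => 2 * ρ < G i := by
    intro i hi
    rw [Finset.mem_Ico] at hi
    simp only [Finset.mem_filter, Finset.mem_range]
    exact ⟨hi.2, hcon.trans_le (le_of_pairwise_seg hG hi.1 hi.2)⟩
  have h3 := Finset.card_le_card h2
  rw [Nat.card_Ico] at h3
  -- Here `n - k` is truncated to `0` and counting gives no contradiction. The artificial gap `0` at
  -- the last index still forces `G 0 ≤ 0`.
  have hkn : n < k := by omega
  have h0 : (0 : ℝ) ∈ seg G 0 n := by
    rw [hp.mem_iff, mem_seg]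
    exact ⟨n - 1, Nat.zero_le _, by omega, by rw [gap, if_neg (by omega)]⟩
  obtain ⟨i, _, hi, h0⟩ := mem_seg.1 h0
  have := le_of_pairwise_seg hG (i := n - k) (j := i) (by omega) hi
  linarith

theorem sorted_gap_nonneg (hT : (seg T 0 n).Pairwise (· ≤ ·))
    (hp : (seg G 0 n).Perm (seg (gap T n) 0 n)) {i : ℕ} (hi : i < n) : 0 ≤ G i := by
  have : G i ∈ seg (gap T n) 0 n := by
    rw [← hp.mem_iff, mem_seg]
    exact ⟨i, Nat.zero_le _, hi, rfl⟩
  obtain ⟨j, _, _, hj⟩ := mem_seg.1 this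
  rw [← hj]
  exact gap_nonneg hT j

/-- In sorted order, only the positions strictly after `n - k` can hold larger values. -/
theorem card_sorted_gap_lt (hG : (seg G 0 n).Pairwise (· ≤ ·))
    (hp : (seg G 0 n).Perm (seg (gap T n) 0 n)) (hk : 0 < k) (hn : 0 < n) :
    ((Finset.range n).filter fun i => G (n - k) < gap T n i).card < k := by
  rw [card_filter_gap hp]
  have h : ((Finset.range n).filter fun i => G (n - k) < G i) ⊆ Finset.Ioo (n - k) n := by
    intro i hi
    simp only [Finset.mem_filter, Finset.mem_range] at hi
    rw [Finset.mem_Ioo]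
    refine ⟨?_, hi.1⟩
    by_contra! hcon
    exact absurd hi.2 (not_lt.2 (le_of_pairwise_seg hG hcon (by omega)))
  have := Finset.card_le_card h
  rw [Nat.card_Ioo] at this
  omega

end

/-! ### Projection to the line -/

section Geometry

variable {d : ℕ} (a v x : EuclideanSpace ℝ (Fin d))

/-- The parameter of the orthogonal projection of `x` to the line through `a` with
direction `v`. -/
noncomputable def projParam : ℝ :=
  (∑ j, (x j - a j) * v j) / ∑ j, v j * v j

theorem norm_sq_eq_sum : ‖v‖ ^ 2 = ∑ j, v j * v j := by
  rw [EuclideanSpace.norm_sq_eq]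
  simp [sq]

/-- Pythagoras, by expanding the squared distance as a quadratic polynomial in the parameter. The
two inequalities below drop one summand each. -/
theorem dist_linePoint_sq (hv : v ≠ 0) (t : ℝ) : dist x (linePoint a v t) ^ 2 =
    dist x (linePoint a v (projParam a v x)) ^ 2 + (|projParam a v x - t| * ‖v‖) ^ 2 := by
  have h0 : ∑ j, v j * v j ≠ 0 := by
    rw [← norm_sq_eq_sum]
    exact pow_ne_zero _ (norm_ne_zero_iff.2 hv)
  have hp : projParam a v x * ∑ j, v j * v j = ∑ j, (x j - a j) * v j := by
    rw [projParam, div_mul_cancel₀ _ h0]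
  have hd : ∀ u, dist x (linePoint a v u) ^ 2 =
      ∑ j, (x j - a j) * (x j - a j) - 2 * u * ∑ j, (x j - a j) * v j +
        u ^ 2 * ∑ j, v j * v j := by
    intro u
    rw [dist_eq_norm, norm_sq_eq_sum, Finset.mul_sum, Finset.mul_sum, ← Finset.sum_sub_distrib,
      ← Finset.sum_add_distrib]
    refine Finset.sum_congr rfl fun j _ => ?_
    simp only [linePoint, PiLp.sub_apply, PiLp.add_apply, PiLp.smul_apply, smul_eq_mul]
    ring
  rw [hd, hd, mul_pow, sq_abs, norm_sq_eq_sum, ← hp]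
  ring

theorem dist_projParam_le (hv : v ≠ 0) (t : ℝ) :
    dist x (linePoint a v (projParam a v x)) ≤ dist x (linePoint a v t) := by
  refine abs_le_of_sq_le_sq' ?_ dist_nonneg |>.2
  rw [dist_linePoint_sq a v x hv t]
  exact le_add_of_nonneg_right (sq_nonneg _)

theorem abs_projParam_sub_le (hv : v ≠ 0) (t : ℝ) :
    |projParam a v x - t| * ‖v‖ ≤ dist x (linePoint a v t) := by
  refine abs_le_of_sq_le_sq' ?_ dist_nonneg |>.2
  rw [dist_linePoint_sq a v x hv t]
  exact le_add_of_nonneg_left (sq_nonneg _)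

theorem dist_linePoint (t u : ℝ) : dist (linePoint a v t) (linePoint a v u) = |t - u| * ‖v‖ := by
  rw [dist_eq_norm, linePoint, linePoint, add_sub_add_left_eq_sub, ← sub_smul, norm_smul,
    Real.norm_eq_abs]

end Geometry

/-! ### From interval coverings to clusterings and back -/

section Solution

variable {d n p q m : ℕ} {P : Fin n → EuclideanSpace ℝ (Fin d)} {a v : EuclideanSpace ℝ (Fin d)}
  {α β w H : ℝ} {T : ℕ → ℝ} {J : ℕ → ℕ} {c e : ℕ → ℝ}

theorem abs_sub_bound {s t x w β : ℝ} (h₁ : s ≤ t) (h₂ : t ≤ s + w) (hx : |x - (s + w / 2)| ≤ β / 2) :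
    |t - x| ≤ (w + β) / 2 := by
  rw [abs_le] at *
  constructor <;> linarith [hx.1, hx.2]

theorem range_subset_of_cover {k : ℕ} (hm : m ≤ k) (hpos : 0 < m)
    (h : ∀ i, ∃ j < m, |projParam a v (P i) - c j| ≤ w)
    (hH : ∀ i, dist (P i) (linePoint a v (projParam a v (P i))) ≤ H) :
    Set.range P ⊆ ⋃ i, Metric.closedBall (centers a v m c k i) (‖v‖ * w + H) := by
  rintro _ ⟨i, rfl⟩
  obtain ⟨j, hj, hle⟩ := h i
  rw [Set.mem_iUnion]
  refine ⟨⟨j, by omega⟩, ?_⟩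
  rw [Metric.mem_closedBall]
  refine (dist_triangle _ (linePoint a v (projParam a v (P i))) _).trans ?_
  have : min j (m - 1) = j := by omega
  simp only [centers, this, dist_linePoint]
  have := mul_le_mul_of_nonneg_right hle (norm_nonneg v)
  linarith [hH i]

/-- Centers at distance `β / 2` on both sides of the centers of intervals of length at least `2 * β`
form a feasible solution. -/
theorem isFeasibleSolution_of_starts (hv : v ≠ 0) (hβ : β * ‖v‖ = α) (hβ0 : 0 ≤ β)
    (hw : 2 * β ≤ w) (hS : Starts T n w J m) (hmp : m ≤ p) (hmq : m ≤ q) (hH0 : 0 ≤ H)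
    (hT : ∀ i, ∃ l < n, T l = projParam a v (P i))
    (hH : ∀ i, dist (P i) (linePoint a v (projParam a v (P i))) ≤ H)
    (hc : ∀ j < m, c j = T (J j) + (w - β) / 2) (he : ∀ j < m, e j = T (J j) + (w + β) / 2) :
    IsFeasibleSolution P (line a v) α (‖v‖ * ((w + β) / 2) + H) (centers a v m c p)
      (centers a v m e q) := by
  have hm := hS.pos
  refine ⟨?_, fun i => ⟨_, rfl⟩, fun i => ⟨_, rfl⟩, range_subset_of_cover hmp hm (fun i => ?_) hH,
    range_subset_of_cover hmq hm (fun i => ?_) hH, fun i j => ?_⟩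
  · have := norm_nonneg v
    have : 0 ≤ (w + β) / 2 := by linarith
    positivity
  · obtain ⟨l, hl, hTl⟩ := hT i
    obtain ⟨j, hj, h1, h2⟩ := hS.cover l hl
    refine ⟨j, hj, hTl ▸ abs_sub_bound h1 h2 ?_⟩
    rw [hc j hj, abs_le]
    constructor <;> linarith
  · obtain ⟨l, hl, hTl⟩ := hT i
    obtain ⟨j, hj, h1, h2⟩ := hS.cover l hl
    refine ⟨j, hj, hTl ▸ abs_sub_bound h1 h2 ?_⟩
    rw [he j hj, abs_le]
    constructor <;> linarith
  · simp only [centers, dist_linePoint]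
    rw [← hβ]
    refine mul_le_mul_of_nonneg_right ?_ (norm_nonneg v)
    generalize hx : min (i : ℕ) (m - 1) = x
    generalize hy : min (j : ℕ) (m - 1) = y
    rw [hc x (by omega), he y (by omega)]
    -- A red and a blue center of the same interval are exactly `β` apart. If the blue interval is
    -- further right, the distance exceeds `w + β`; if it is further left, the distance exceeds `w -
    -- β`, which is at least `β` by `2 * β ≤ w`.
    rcases lt_trichotomy x y with h | rfl | h
    · have := hS.add_lt (by linarith) h (by omega)
      rw [abs_sub_comm]
      exact le_trans (by linarith) (le_abs_self _)
    · rw [abs_sub_comm]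
      exact le_trans (by linarith) (le_abs_self _)
    · have := hS.add_lt (by linarith) h (by omega)
      exact le_trans (by linarith) (le_abs_self _)

/-- Projecting to the line does not increase distances to points of the line, and the parameters
rescale by `‖v‖`. -/
theorem coverable_of_subset {k : ℕ} {r : ℝ} {f : Fin k → EuclideanSpace ℝ (Fin d)} (hv : v ≠ 0)
    (hf : ∀ j, f j ∈ line a v) (hP : Set.range P ⊆ ⋃ j, Metric.closedBall (f j) r)
    (hT : ∀ l < n, ∃ i, T l = projParam a v (P i)) : Coverable T n k (r / ‖v‖) := by
  choose u hu using hf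
  refine ⟨u, fun l hl => ?_⟩
  obtain ⟨i, hi⟩ := hT l hl
  obtain ⟨j, hj⟩ := Set.mem_iUnion.1 (hP ⟨i, rfl⟩)
  refine ⟨j, ?_⟩
  rw [le_div_iff₀ (norm_pos_iff.2 hv), hi]
  refine (abs_projParam_sub_le a v (P i) hv (u j)).trans ?_
  rw [hu j]
  exact hj

theorem le_four_mul_of_isFeasibleRadius (hv : v ≠ 0) (hn : 0 < n) (hβ : β * ‖v‖ = α)
    (hT : ∀ l < n, ∃ i, T l = projParam a v (P i))
    (hw : ∀ ρ, 0 ≤ ρ → Coverable T n (min p q) ρ → β ≤ 2 * ρ → w ≤ 4 * ρ)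
    (hH : H = 0 ∨ ∃ i, H = dist (P i) (linePoint a v (projParam a v (P i)))) {r : ℝ}
    (hr : IsFeasibleRadius P (line a v) p q α r) :
    ‖v‖ * ((w + β) / 2) + H ≤ 4 * r := by
  obtain ⟨c, e, hr0, hc, he, hPc, hPe, hα⟩ := hr
  have hv' := norm_pos_iff.2 hv
  have hHr : H ≤ r := by
    rcases hH with rfl | ⟨i, rfl⟩
    · exact hr0
    · obtain ⟨j, hj⟩ := Set.mem_iUnion.1 (hPc ⟨i, rfl⟩)
      obtain ⟨t, ht⟩ := hc j
      refine (dist_projParam_le a v (P i) hv t).trans ?_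
      rw [ht]
      exact hj
  -- Each color covers all points on its own, so the color with fewer centers can be used.
  have hcov : Coverable T n (min p q) (r / ‖v‖) := by
    rcases min_choice p q with h | h
    · rw [h]
      exact coverable_of_subset hv hc hPc hT
    · rw [h]
      exact coverable_of_subset hv he hPe hT
  -- Any single point lies within `r` of both a red and a blue center; this is where `0 < n` enters.
  have hαr : α ≤ 2 * r := by
    obtain ⟨j, hj⟩ := Set.mem_iUnion.1 (hPc ⟨⟨0, hn⟩, rfl⟩)
    obtain ⟨l, hl⟩ := Set.mem_iUnion.1 (hPe ⟨⟨0, hn⟩, rfl⟩)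
    rw [Metric.mem_closedBall] at hj hl
    have := dist_triangle_left (c j) (e l) (P ⟨0, hn⟩)
    linarith [hα j l]
  have hβr : β ≤ 2 * (r / ‖v‖) := by
    rw [← mul_div_assoc, le_div_iff₀ hv', hβ]
    exact hαr
  have h1 := hw _ (by positivity) hcov hβr
  -- With `ρ = r / ‖v‖`, the summand `w / 2` is at most `2ρ` and `β / 2` at most `ρ`. The fourth `r`
  -- of the final bound is `H`.
  have h2 : (w + β) / 2 ≤ 3 * (r / ‖v‖) := by linarith
  have h3 := mul_le_mul_of_nonneg_left h2 hv'.le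
  have h4 : ‖v‖ * (3 * (r / ‖v‖)) = 3 * r := by field_simp
  linarith

end Solution

end RedBlue

/-! ### Greedy covering and the search for the interval length -/

namespace RedBlue

open RealRAM

theorem Starts.le_index {T : ℕ → ℝ} {n m : ℕ} {w : ℝ} {J : ℕ → ℕ} (h : Starts T n w J m) {j : ℕ}
    (hj : j < m) : j ≤ J j := by
  induction j with
  | zero => exact Nat.zero_le _
  | succ j ih => exact (ih (by omega)).trans_lt (h.succ_lt j hj)

theorem Starts.count_le {T : ℕ → ℝ} {n m : ℕ} {w : ℝ} {J : ℕ → ℕ} (h : Starts T n w J m) :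
    m ≤ n := by
  have hp := h.pos
  have h1 := h.le_index (j := m - 1) (by omega)
  have h2 := h.lt (m - 1) (by omega)
  omega

theorem Starts.congr {T : ℕ → ℝ} {n m : ℕ} {w : ℝ} {J J' : ℕ → ℕ} (h : Starts T n w J m)
    (hJ : ∀ j < m, J' j = J j) : Starts T n w J' m := by
  refine ⟨h.pos, fun j hj => ?_, fun j hj => ?_, fun j hj => ?_, fun i hi => ?_⟩
  · rw [hJ j hj]
    exact h.lt j hj
  · rw [hJ j (by omega), hJ _ hj]
    exact h.succ_lt j hj
  · rw [hJ j (by omega), hJ _ hj]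
    exact h.apart j hj
  · obtain ⟨j, hj, h'⟩ := h.cover i hi
    exact ⟨j, hj, by rwa [hJ j hj]⟩

/-- Greedy step for a number beyond the current interval: it opens a new one. `Starts.skip` is the
complementary case. -/
theorem Starts.snoc {T : ℕ → ℝ} {i m : ℕ} {w : ℝ} {J : ℕ → ℕ} (h : Starts T i w J m) (hw : 0 ≤ w)
    (hJ : J m = i) (hlt : T (J (m - 1)) + w < T i) : Starts T (i + 1) w J (m + 1) := by
  have hp := h.pos
  have hm : ∀ j, j + 1 < m + 1 → j + 1 < m ∨ j = m - 1 ∧ j + 1 = m := fun j hj => by omega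
  refine ⟨Nat.succ_pos _, fun j hj => ?_, fun j hj => ?_, fun j hj => ?_, fun l hl => ?_⟩
  · rcases Nat.lt_succ_iff_lt_or_eq.1 hj with hj | rfl
    · exact (h.lt j hj).trans (Nat.lt_succ_self i)
    · omega
  · rcases hm j hj with hj | ⟨hj, hj'⟩
    · exact h.succ_lt j hj
    · rw [hj', hJ]
      exact h.lt j (by omega)
  · rcases hm j hj with hj | ⟨hj, hj'⟩
    · exact h.apart j hj
    · rw [hj', hJ, hj]
      exact hlt
  · rcases Nat.lt_succ_iff_lt_or_eq.1 hl with hl | rfl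
    · obtain ⟨j, hj, h'⟩ := h.cover l hl
      exact ⟨j, by omega, h'⟩
    · exact ⟨m, Nat.lt_succ_self m, by rw [hJ], by rw [hJ]; linarith⟩

theorem Starts.skip {T : ℕ → ℝ} {i m : ℕ} {w : ℝ} {J : ℕ → ℕ} (h : Starts T i w J m)
    (hle : T (J (m - 1)) ≤ T i) (hge : T i ≤ T (J (m - 1)) + w) : Starts T (i + 1) w J m := by
  have hp := h.pos
  refine ⟨hp, fun j hj => (h.lt j hj).trans (Nat.lt_succ_self i), h.succ_lt, h.apart,
    fun l hl => ?_⟩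
  rcases Nat.lt_succ_iff_lt_or_eq.1 hl with hl | rfl
  · exact h.cover l hl
  · exact ⟨m - 1, by omega, hle, hge⟩

/-- The loop of `greedyProg`. -/
def greedyLoop : Prog :=
  .loop (ilt (ivar 5 1) (ivar 0 0))
    (.seq
      (.branch (rlt (.add (.get 7 (.get 4 (.sub (ivar 5 0) (.const 1)))) (rvar 10 2))
          (.get 7 (ivar 5 1)))
        (.seq (.setI 4 (ivar 5 0) (ivar 5 1)) (.setI 5 (.const 0) (.add (ivar 5 0) (.const 1))))
        .skip)
      (.setI 5 (.const 1) (.add (ivar 5 1) (.const 1))))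

/-- Greedy covering of the sorted real array `7` by intervals of the length given in cell `2` of
the real array `10`. The indices of the left ends go to the integer array `4`, their number to
cell `0` of the integer array `5`. -/
def greedyProg : Prog :=
  .seq (.setI 4 (.const 0) (.const 0))
  (.seq (.setI 5 (.const 0) (.const 1))
  (.seq (.setI 5 (.const 1) (.const 1)) greedyLoop))

theorem wp_greedyProg {s : Store} {n : ℕ} (hn : s.int 0 0 = n) (hn0 : 0 < n)
    (hT : (seg (s.real 7) 0 n).Pairwise (· ≤ ·)) (hw : 0 ≤ s.real 10 2) :
    WP greedyProg s fun t s' => t ≤ 60 * n + 20 ∧ Frame [4, 5] [] s s' ∧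
      Starts (s.real 7) n (s.real 10 2) (s'.int 4) (s'.int 5 0) := by
  simp only [greedyProg, wp_seq, wp_setI, IExp.eval, IExp.cost]
  -- Invariant: the starts found so far form a greedy covering of the prefix that has been read. It
  -- begins with the prefix of length `1`, whence the fuel `n - 1`.
  refine (wp_loop 60 (fun r s' => Frame [4, 5] [] s s' ∧ r + s'.int 5 1 = n ∧
    Starts (s.real 7) (s'.int 5 1) (s.real 10 2) (s'.int 4) (s'.int 5 0))
    (Q := fun s' => Frame [4, 5] [] s s' ∧
      Starts (s.real 7) n (s.real 10 2) (s'.int 4) (s'.int 5 0)) ?_ ?_ (n - 1) _ ?_).mono ?_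
  · rintro r s' ⟨frame, left, hS⟩ hb
    simp only [Test.Holds, IExp.eval, not_le, frame.1 0 (by simp), hn] at hb
    have e7 : s'.real 7 = s.real 7 := frame.2 7 (by simp)
    have e10 : s'.real 10 = s.real 10 := frame.2 10 (by simp)
    simp only [wp_seq, wp_branch, wp_skip, wp_setI, IExp.eval, RExp.eval, Test.Holds, IExp.cost,
      RExp.cost, Test.cost, not_le, not_lt, e7, e10]
    refine ⟨fun h => ⟨r - 1, by omega, ?_, ?_, ?_⟩, fun h => ⟨r - 1, by omega, ?_, ?_, ?_⟩⟩
    · exact ((frame.writeI (by simp) _ _).writeI (by simp) _ _).writeI (by simp) _ _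
    · simp
      omega
    · simp
      refine Starts.snoc (hS.congr fun j hj => ?_) hw (by simp) ?_
      · rw [Function.update_of_ne hj.ne]
      · have := hS.pos
        rwa [Function.update_of_ne (by omega)]
    · exact frame.writeI (by simp) _ _
    · simp
      omega
    · simp
      have := hS.pos
      exact hS.skip (le_of_pairwise_seg hT (hS.lt _ (by omega)).le hb) h
  · rintro r s' ⟨frame, left, hS⟩ hb
    simp only [Test.Holds, IExp.eval, not_le, frame.1 0 (by simp), hn] at hb
    refine ⟨frame, ?_⟩
    rwa [show s'.int 5 1 = n by omega] at hS
  · refine ⟨(((Frame.refl _ _ s).writeI (by simp) _ _).writeI (by simp) _ _).writeI (by simp) _ _,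
      ?_, ?_⟩
    · simp
      omega
    · simp
      refine ⟨one_pos, fun j hj => ?_, fun j hj => by omega, fun j hj => by omega,
        fun i hi => ⟨0, one_pos, ?_⟩⟩
      · obtain rfl : j = 0 := by omega
        simp
      · obtain rfl : i = 0 := by omega
        simpa using hw
  · rintro t s' ⟨ht, h⟩
    simp only [Test.cost, IExp.cost] at ht
    exact ⟨by omega, h⟩

/-- The gaps of the real array `7` are stored in the real array `8`. -/
def gapProg : Prog :=
  .seq (.setI 5 (.const 1) (.const 0))
  (.loop (ilt (ivar 5 1) (ivar 0 0))
    (.seq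
      (.branch (ilt (.add (ivar 5 1) (.const 1)) (ivar 0 0))
        (.setR 8 (ivar 5 1) (.sub (.get 7 (.add (ivar 5 1) (.const 1))) (.get 7 (ivar 5 1))))
        (.setR 8 (ivar 5 1) (.const 0)))
      (.setI 5 (.const 1) (.add (ivar 5 1) (.const 1)))))

theorem wp_gapProg {s : Store} {n : ℕ} (hn : s.int 0 0 = n) :
    WP gapProg s fun t s' => t ≤ 60 * n + 20 ∧ Frame [5] [8] s s' ∧
      seg (s'.real 8) 0 n = seg (gap (s.real 7) n) 0 n := by
  simp only [gapProg, wp_seq, wp_setI, IExp.eval, IExp.cost]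
  refine (wp_loop 60 (fun r s' => Frame [5] [8] s s' ∧ r + s'.int 5 1 = n ∧
    ∀ i < s'.int 5 1, s'.real 8 i = gap (s.real 7) n i)
    (Q := fun s' => Frame [5] [8] s s' ∧ seg (s'.real 8) 0 n = seg (gap (s.real 7) n) 0 n)
    ?_ ?_ n _ ?_).mono ?_
  · rintro r s' ⟨frame, left, hS⟩ hb
    have e0 : s'.int 0 0 = n := by rw [frame.1 0 (by simp), hn]
    have e7 : s'.real 7 = s.real 7 := frame.2 7 (by simp)
    simp only [Test.Holds, IExp.eval, not_le, e0] at hb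
    simp only [wp_seq, wp_branch, wp_setI, wp_setR, IExp.eval, RExp.eval, Test.Holds, IExp.cost,
      RExp.cost, Test.cost, not_le, not_lt, e7, e0]
    refine ⟨fun h => ⟨r - 1, by omega, ?_, ?_, ?_⟩, fun h => ⟨r - 1, by omega, ?_, ?_, ?_⟩⟩
    all_goals try exact (frame.writeR (by simp) _ _).writeI (by simp) _ _
    all_goals simp
    any_goals omega
    all_goals
      intro i hi
      rcases Nat.lt_or_eq_of_le hi with hi | rfl
      · rw [Function.update_of_ne hi.ne, hS i hi]
      · rw [Function.update_self, gap]
        simp [h]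
  · rintro r s' ⟨frame, left, hS⟩ hb
    simp only [Test.Holds, IExp.eval, not_le, frame.1 0 (by simp), hn] at hb
    exact ⟨frame, seg_congr fun i _ hi => hS i (by omega)⟩
  · exact ⟨(Frame.refl _ _ s).writeI (by simp) _ _, by simp, by simp⟩
  · rintro t s' ⟨ht, h⟩
    simp only [Test.cost, IExp.cost] at ht
    exact ⟨by omega, h⟩

/-- Doubling of the interval length until the greedy covering has at most `k` intervals, where `k`
is in cell `0` of the integer array `6`. -/
def doubleLoop : Prog :=
  .loop (ilt (ivar 6 0) (ivar 5 0))
    (.seq (.setR 10 (.const 2) (.add (rvar 10 2) (rvar 10 2))) greedyProg)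

/-- Search for an interval length, given the sorted gaps in the real array `8` and the separation
of the parameters in cell `3` of the real array `10`. -/
def searchProg : Prog :=
  .seq (.setR 10 (.const 2) (.get 8 (.sub (ivar 0 0) (ivar 6 0))))
  (.seq
    (.branch (rlt (rvar 10 2) (.add (rvar 10 3) (rvar 10 3)))
      (.setR 10 (.const 2) (.add (rvar 10 3) (rvar 10 3))) .skip)
  (.seq greedyProg doubleLoop))

/-- The invariant of `doubleLoop`. -/
structure DoubleInv (s₀ : Store) (n k : ℕ) (r : ℕ) (s : Store) : Prop where
  frame : Frame [4, 5] [10] s₀ s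
  loc : ∀ c, c ≠ 2 → s.real 10 c = s₀.real 10 c
  starts : Starts (s₀.real 7) n (s.real 10 2) (s.int 4) (s.int 5 0)
  nonneg : 0 ≤ s.real 10 2
  sep : 2 * s₀.real 10 3 ≤ s.real 10 2
  grown : ∃ e, r + e = Nat.clog 2 n ∧ 2 ^ e * s₀.real 8 (n - k) ≤ s.real 10 2
  opt : ∀ ρ, 0 ≤ ρ → Coverable (s₀.real 7) n k ρ → s₀.real 10 3 ≤ 2 * ρ → s.real 10 2 ≤ 4 * ρ

theorem wp_doubleLoop {s₀ : Store} {n k : ℕ} (hn : s₀.int 0 0 = n) (hn0 : 0 < n)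
    (hk : s₀.int 6 0 = k) (hk0 : 0 < k) (hT : (seg (s₀.real 7) 0 n).Pairwise (· ≤ ·))
    (hG : (seg (s₀.real 8) 0 n).Pairwise (· ≤ ·))
    (hp : (seg (s₀.real 8) 0 n).Perm (seg (gap (s₀.real 7) n) 0 n)) {s : Store}
    (h : DoubleInv s₀ n k (Nat.clog 2 n) s) :
    WP doubleLoop s fun t s' => t ≤ (60 * n + 60) * Nat.clog 2 n + 7 ∧ s'.int 5 0 ≤ k ∧
      ∃ r, DoubleInv s₀ n k r s' := by
  refine wp_loop (60 * n + 60) (DoubleInv s₀ n k) ?_ ?_ _ s h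
  · intro r s h hb
    obtain ⟨frame, loc, starts, nonneg, sep, ⟨e, he, hle⟩, opt⟩ := h
    have e0 : s.int 0 0 = n := by rw [frame.1 0 (by simp), hn]
    have e6 : s.int 6 0 = k := by rw [frame.1 6 (by simp), hk]
    have e7 : s.real 7 = s₀.real 7 := frame.2 7 (by simp)
    simp only [Test.Holds, IExp.eval, not_le, e6] at hb
    have hg := sorted_gap_nonneg hT hp (i := n - k) (by omega)
    -- After `Nat.clog 2 n` doublings `w` is at least `n` times the initial gap, so the greedy
    -- covering has at most `k` intervals and the guard fails.
    have hr : 0 < r := by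
      rw [Nat.pos_iff_ne_zero]
      rintro rfl
      refine absurd (starts.le_of_gaps hg ?_ (card_sorted_gap_lt hG hp hk0 hn0)) (not_le.2 hb)
      refine le_trans (mul_le_mul_of_nonneg_right ?_ hg) hle
      rw [show e = Nat.clog 2 n by omega]
      exact_mod_cast Nat.le_pow_clog one_lt_two n
    simp only [wp_seq, wp_setR, IExp.eval, RExp.eval, IExp.cost, RExp.cost, Test.cost]
    refine (wp_greedyProg (n := n) (by simpa using e0) hn0 ?_ ?_).mono ?_
    · simpa [e7] using hT
    · simpa using nonneg
    rintro t s' ⟨ht, frame', hS⟩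
    have e10 := frame'.2 10 (by simp)
    simp only [writeR_real, if_true] at e10
    simp [e7] at hS
    refine ⟨r - 1, ?_, ?_, fun c hc => ?_, ?_, ?_, ?_, ⟨e + 1, by omega, ?_⟩, fun ρ h0 hc hβ => ?_⟩
    · obtain ⟨r, rfl⟩ : ∃ r', r = r' + 1 := ⟨r - 1, by omega⟩
      simp only [Nat.add_sub_cancel, Nat.mul_add]
      omega
    · exact (frame.writeR (by simp) _ _).trans (frame'.mono (by simp) (by simp))
    · rw [e10, Function.update_of_ne hc, loc c hc]
    all_goals rw [e10, Function.update_self]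
    · exact hS
    · linarith
    · linarith
    · rw [pow_succ]
      linarith
    -- The covering with the old length was too large, so that length is below `2 * ρ` for every
    -- admissible `ρ`; its double stays below `4 * ρ`.
    · have := starts.lt_two_mul nonneg hb hc
      linarith
  · intro r s h hb
    simp only [Test.Holds, IExp.eval, not_le, h.frame.1 6 (by simp), hk, not_lt] at hb
    exact ⟨hb, r, h⟩

theorem wp_searchProg {s : Store} {n k : ℕ} (hn : s.int 0 0 = n) (hn0 : 0 < n)
    (hk : s.int 6 0 = k) (hk0 : 0 < k) (hT : (seg (s.real 7) 0 n).Pairwise (· ≤ ·))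
    (hG : (seg (s.real 8) 0 n).Pairwise (· ≤ ·))
    (hp : (seg (s.real 8) 0 n).Perm (seg (gap (s.real 7) n) 0 n)) :
    WP searchProg s fun t s' => t ≤ (60 * n + 60) * (Nat.clog 2 n + 1) ∧ s'.int 5 0 ≤ k ∧
      ∃ r, DoubleInv s n k r s' := by
  have hg := sorted_gap_nonneg hT hp (i := n - k) (by omega)
  -- Both outcomes of the branch set the length to this maximum, so the rest is proved once.
  have main : ∀ s₁, Frame [] [10] s s₁ → (∀ c, c ≠ 2 → s₁.real 10 c = s.real 10 c) →
      s₁.real 10 2 = max (s.real 8 (n - k)) (2 * s.real 10 3) →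
      WP (.seq greedyProg doubleLoop) s₁ fun t s' =>
        t ≤ (60 * n + 60) * Nat.clog 2 n + (60 * n + 27) ∧ s'.int 5 0 ≤ k ∧
        ∃ r, DoubleInv s n k r s' := by
    intro s₁ frame loc hw
    rw [wp_seq]
    have e7 : s₁.real 7 = s.real 7 := frame.2 7 (by simp)
    refine (wp_greedyProg (n := n) (by rw [frame.1 0 (by simp), hn]) hn0 (e7 ▸ hT) ?_).mono ?_
    · rw [hw]
      exact le_max_of_le_left hg
    rintro t s₂ ⟨ht, frame', hS⟩
    have e10 := frame'.2 10 (by simp)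
    refine (wp_doubleLoop hn hn0 hk hk0 hT hG hp (s := s₂) ?_).mono ?_
    · refine ⟨(frame.mono (by simp) (by simp)).trans (frame'.mono (by simp) (by simp)),
        fun c hc => ?_, ?_, ?_, ?_, ⟨0, by omega, ?_⟩, fun ρ h0 hc hβ => ?_⟩
      · rw [e10, loc c hc]
      · rw [e10, ← e7]
        exact hS
      all_goals rw [e10, hw]
      · exact le_max_of_le_left hg
      · exact le_max_right _ _
      · simp
      · refine max_le ?_ (by linarith)
        linarith [sorted_gap_le hT hG hp h0 hn0 hc]
    · rintro t' s' ⟨ht', h⟩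
      exact ⟨by omega, h⟩
  simp only [searchProg, wp_seq (c₁ := .setR _ _ _), wp_setR, wp_seq (c₁ := .branch _ _ _),
    wp_branch, wp_skip, IExp.eval, RExp.eval, IExp.cost, RExp.cost, Test.cost, Test.Holds]
  refine ⟨fun h => (main _ ?_ (fun c hc => ?_) ?_).mono ?_,
    fun h => (main _ ?_ (fun c hc => ?_) ?_).mono ?_⟩
  · exact ((Frame.refl _ _ s).writeR (by simp) _ _).writeR (by simp) _ _
  · simp [hc]
  · simp [hn, hk] at h ⊢
    rw [max_eq_right (by linarith)]
    ring
  · rintro t s' ⟨ht, h⟩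
    refine ⟨?_, h⟩
    rw [Nat.mul_add]
    omega
  · exact (Frame.refl _ _ s).writeR (by simp) _ _
  · simp [hc]
  · simp [hn, hk] at h ⊢
    linarith
  · rintro t s' ⟨ht, h⟩
    refine ⟨?_, h⟩
    rw [Nat.mul_add]
    omega

/-- Output of the red and blue centers, of their numbers, and of the radius of covering. -/
def outputProg : Prog :=
  .seq (.setI 5 (.const 1) (.const 0))
  (.seq (.loop (ilt (ivar 5 1) (ivar 5 0))
    (.seq (.setR 4 (ivar 5 1) (.add (.get 7 (.get 4 (ivar 5 1)))
      (.div (.sub (rvar 10 2) (rvar 10 3)) (.const 2))))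
    (.seq (.setR 5 (ivar 5 1) (.add (.get 7 (.get 4 (ivar 5 1)))
      (.div (.add (rvar 10 2) (rvar 10 3)) (.const 2))))
    (.setI 5 (.const 1) (.add (ivar 5 1) (.const 1))))))
  (.seq (.setI 1 (.const 0) (ivar 5 0))
  (.seq (.setI 1 (.const 1) (ivar 5 0))
  (.setR 6 (.const 0) (.add (.mul (rvar 10 5) (.div (.add (rvar 10 2) (rvar 10 3)) (.const 2)))
    (rvar 10 1))))))

theorem wp_outputProg {s : Store} {m : ℕ} (hm : s.int 5 0 = m) :
    WP outputProg s fun t s' => t ≤ 60 * m + 40 ∧ s'.int 1 0 = m ∧ s'.int 1 1 = m ∧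
      s'.real 6 0 = s.real 10 5 * ((s.real 10 2 + s.real 10 3) / 2) + s.real 10 1 ∧
      (∀ j < m, s'.real 4 j = s.real 7 (s.int 4 j) + (s.real 10 2 - s.real 10 3) / 2) ∧
      ∀ j < m, s'.real 5 j = s.real 7 (s.int 4 j) + (s.real 10 2 + s.real 10 3) / 2 := by
  simp only [outputProg, wp_seq (c₁ := .setI _ _ _), wp_seq (c₁ := .loop _ _), wp_setI, wp_setR,
    IExp.eval, IExp.cost, RExp.eval, RExp.cost]
  refine (wp_loop 60 (fun r s' => Frame [5] [4, 5] s s' ∧ s'.int 5 0 = m ∧ r + s'.int 5 1 = m ∧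
    (∀ j < s'.int 5 1, s'.real 4 j = s.real 7 (s.int 4 j) + (s.real 10 2 - s.real 10 3) / 2) ∧
    ∀ j < s'.int 5 1, s'.real 5 j = s.real 7 (s.int 4 j) + (s.real 10 2 + s.real 10 3) / 2)
    (Q := fun s' => Frame [5] [4, 5] s s' ∧ s'.int 5 0 = m ∧
    (∀ j < m, s'.real 4 j = s.real 7 (s.int 4 j) + (s.real 10 2 - s.real 10 3) / 2) ∧
    ∀ j < m, s'.real 5 j = s.real 7 (s.int 4 j) + (s.real 10 2 + s.real 10 3) / 2)
    ?_ ?_ m _ ?_).mono ?_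
  · rintro r s' ⟨frame, h0, left, hr, hb'⟩ hb
    have e7 : s'.real 7 = s.real 7 := frame.2 7 (by simp)
    have e10 : s'.real 10 = s.real 10 := frame.2 10 (by simp)
    have e4 : s'.int 4 = s.int 4 := frame.1 4 (by simp)
    simp only [Test.Holds, IExp.eval, not_le] at hb
    simp only [wp_seq, wp_setI, wp_setR, IExp.eval, RExp.eval, IExp.cost, RExp.cost, Test.cost]
    refine ⟨r - 1, by omega, ?_, ?_, ?_, ?_, ?_⟩
    · exact ((frame.writeR (by simp) _ _).writeR (by simp) _ _).writeI (by simp) _ _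
    · simpa using h0
    · simp
      omega
    all_goals
      simp [e7, e10, e4]
      intro i hi
      rcases Nat.lt_or_eq_of_le hi with hi | rfl
      · rw [Function.update_of_ne hi.ne]
        first | exact hr i hi | exact hb' i hi
      · rw [Function.update_self]
  · rintro r s' ⟨frame, h0, left, hr, hb'⟩ hb
    simp only [Test.Holds, IExp.eval, not_le] at hb
    obtain rfl : s'.int 5 1 = m := by omega
    exact ⟨frame, h0, hr, hb'⟩
  · refine ⟨(Frame.refl _ _ s).writeI (by simp) _ _, ?_, ?_, ?_, ?_⟩
    all_goals simp [hm]
  · rintro t s' ⟨ht, frame, h0, hr, hb⟩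
    simp only [Test.cost, IExp.cost] at ht
    have e10 : s'.real 10 = s.real 10 := frame.2 10 (by simp)
    refine ⟨by omega, ?_⟩
    simpa [h0, e10] using ⟨hr, hb⟩

end RedBlue

/-! ### Computing the projections -/

namespace RedBlue

open RealRAM

/-- The sum of the values of `e`, with cell `2` of the integer array `6` running through
`0, …, d - 1`, is computed in cell `4` of the real array `10`. -/
def sumProg (e : RExp) : Prog :=
  .seq (.setR 10 (.const 4) (.const 0))
  (.seq (.setI 6 (.const 2) (.const 0))
  (.loop (ilt (ivar 6 2) (ivar 0 1))
    (.seq (.setR 10 (.const 4) (.add (rvar 10 4) e))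
      (.setI 6 (.const 2) (.add (ivar 6 2) (.const 1))))))

/-- The states `s` and `s'` agree up to the two variables of `sumProg`. -/
structure SumFrame (s s' : Store) : Prop where
  frame : Frame [6] [10] s s'
  int_eq : ∀ c, c ≠ 2 → s'.int 6 c = s.int 6 c
  real_eq : ∀ c, c ≠ 4 → s'.real 10 c = s.real 10 c

theorem SumFrame.writes {s s' : Store} (h : SumFrame s s') (x : ℝ) (k : ℕ) :
    SumFrame s ((s'.writeR 10 4 x).writeI 6 2 k) := by
  refine ⟨(h.frame.writeR (by simp) _ _).writeI (by simp) _ _, fun c hc => ?_, fun c hc => ?_⟩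
  · simp [hc, h.int_eq c hc]
  · simp [hc, h.real_eq c hc]

/-- The summand is an arbitrary expression, so its value need only be known in states that agree
with `s` up to the accumulator and the counter. -/
theorem wp_sumProg {e : RExp} {s : Store} {d : ℕ} {f : ℕ → ℝ} (hd : s.int 0 1 = d)
    (he : ∀ s', SumFrame s s' → s'.int 6 2 < d → e.eval s' = f (s'.int 6 2)) :
    WP (sumProg e) s fun t s' => t ≤ (e.cost + 30) * d + 20 ∧ SumFrame s s' ∧
      s'.real 10 4 = ∑ j ∈ Finset.range d, f j := by
  simp only [sumProg, wp_seq, wp_setI, wp_setR, IExp.eval, IExp.cost, RExp.eval, RExp.cost]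
  refine (wp_loop (e.cost + 30) (fun r s' => SumFrame s s' ∧ r + s'.int 6 2 = d ∧
    s'.real 10 4 = ∑ j ∈ Finset.range (s'.int 6 2), f j)
    (Q := fun s' => SumFrame s s' ∧ s'.real 10 4 = ∑ j ∈ Finset.range d, f j)
    ?_ ?_ d _ ?_).mono ?_
  · rintro r s' ⟨frame, left, hs⟩ hb
    simp only [Test.Holds, IExp.eval, not_le, frame.frame.1 0 (by simp), hd] at hb
    simp only [wp_seq, wp_setI, wp_setR, IExp.eval, RExp.eval, IExp.cost, RExp.cost, Test.cost]
    refine ⟨r - 1, ?_, frame.writes _ _, ?_, ?_⟩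
    · obtain ⟨r, rfl⟩ : ∃ r', r = r' + 1 := ⟨r - 1, by omega⟩
      simp only [Nat.add_sub_cancel, Nat.mul_add]
      omega
    · simp
      omega
    · simp [Finset.sum_range_succ, hs, he s' frame hb]
  · rintro r s' ⟨frame, left, hs⟩ hb
    simp only [Test.Holds, IExp.eval, not_le, frame.frame.1 0 (by simp), hd] at hb
    rw [show s'.int 6 2 = d by omega] at hs
    exact ⟨frame, hs⟩
  · refine ⟨SumFrame.writes ⟨.refl _ _ s, fun _ _ => rfl, fun _ _ => rfl⟩ _ _, ?_, ?_⟩ <;> simp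
  · rintro t s' ⟨ht, h⟩
    simp only [Test.cost, IExp.cost] at ht
    exact ⟨by omega, h⟩

/-- Projection of the next point: the parameter goes to the real array `7`, and the maximal distance
in cell `1` of the real array `10` is updated. -/
def pointStep : Prog :=
  .seq (sumProg (.mul (.sub (.get 3 (.add (ivar 6 3) (ivar 6 2))) (.get 1 (ivar 6 2)))
    (.get 2 (ivar 6 2))))
  (.seq (.setR 7 (ivar 6 1) (.div (rvar 10 4) (rvar 10 0)))
  (.seq (sumProg (.mul
    (.sub (.get 3 (.add (ivar 6 3) (ivar 6 2)))
      (.add (.get 1 (ivar 6 2)) (.mul (.get 7 (ivar 6 1)) (.get 2 (ivar 6 2)))))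
    (.sub (.get 3 (.add (ivar 6 3) (ivar 6 2)))
      (.add (.get 1 (ivar 6 2)) (.mul (.get 7 (ivar 6 1)) (.get 2 (ivar 6 2)))))))
  (.seq (.branch (rlt (rvar 10 1) (.sqrt (rvar 10 4)))
    (.setR 10 (.const 1) (.sqrt (rvar 10 4))) .skip)
  (.seq (.setI 6 (.const 1) (.add (ivar 6 1) (.const 1)))
  (.setI 6 (.const 3) (.add (ivar 6 3) (ivar 0 1)))))))

/-- Projection of all points. -/
def pointProg : Prog :=
  .seq (.setI 6 (.const 1) (.const 0))
  (.seq (.setI 6 (.const 3) (.const 0))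
  (.seq (.setR 10 (.const 1) (.const 0))
  (.loop (ilt (ivar 6 1) (ivar 0 0)) pointStep)))

section Input

variable {d n : ℕ} {P : Fin n → EuclideanSpace ℝ (Fin d)} {a v : EuclideanSpace ℝ (Fin d)}
  {p q : ℕ} {α : ℝ}

theorem inputStore_real_one (j : Fin d) : (inputStore P a v p q α).real 1 j = a j := by
  simp [inputStore, inputReal]

theorem inputStore_real_two (j : Fin d) : (inputStore P a v p q α).real 2 j = v j := by
  simp [inputStore, inputReal]

theorem inputStore_real_three (i : Fin n) (j : Fin d) :
    (inputStore P a v p q α).real 3 (i * d + j) = P i j := by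
  have hd : 0 < d := j.pos
  have h1 : ((i : ℕ) * d + j) / d = i := by
    rw [Nat.add_comm, Nat.add_mul_div_right _ _ hd, Nat.div_eq_of_lt j.2, Nat.zero_add]
  have h2 : ((i : ℕ) * d + j) % d = j := by
    rw [Nat.add_comm, Nat.add_mul_mod_self_right, Nat.mod_eq_of_lt j.2]
  simp only [inputStore, inputReal]
  rw [dif_pos ⟨by rw [h1]; exact i.2, by rw [h2]; exact j.2⟩]
  simp only [h1, h2]

theorem sum_eq_projParam (i : Fin n) :
    (∑ j ∈ Finset.range d, ((inputStore P a v p q α).real 3 (i * d + j) -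
        (inputStore P a v p q α).real 1 j) * (inputStore P a v p q α).real 2 j) / ‖v‖ ^ 2 =
      projParam a v (P i) := by
  rw [Finset.sum_range, norm_sq_eq_sum, projParam]
  simp only [inputStore_real_one, inputStore_real_two, inputStore_real_three]

theorem sqrt_sum_eq_dist (i : Fin n) (t : ℝ) :
    √(∑ j ∈ Finset.range d, ((inputStore P a v p q α).real 3 (i * d + j) -
        ((inputStore P a v p q α).real 1 j + t * (inputStore P a v p q α).real 2 j)) *
      ((inputStore P a v p q α).real 3 (i * d + j) -
        ((inputStore P a v p q α).real 1 j + t * (inputStore P a v p q α).real 2 j))) =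
      dist (P i) (linePoint a v t) := by
  rw [Finset.sum_range, dist_eq_norm, EuclideanSpace.norm_eq]
  simp only [inputStore_real_one, inputStore_real_two, inputStore_real_three]
  simp [linePoint, sq]

/-- The invariant of the loop of `pointProg`. -/
structure PointInv (P : Fin n → EuclideanSpace ℝ (Fin d)) (a v : EuclideanSpace ℝ (Fin d))
    (s₀ : Store) (r : ℕ) (s : Store) : Prop where
  frame : Frame [6] [7, 10] s₀ s
  left : r + s.int 6 1 = n
  base : s.int 6 3 = s.int 6 1 * d
  loc : ∀ c, c ≠ 1 → c ≠ 4 → s.real 10 c = s₀.real 10 c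
  param : ∀ i : Fin n, (i : ℕ) < s.int 6 1 → s.real 7 i = projParam a v (P i)
  nonneg : 0 ≤ s.real 10 1
  dist_le : ∀ i : Fin n, (i : ℕ) < s.int 6 1 →
    dist (P i) (linePoint a v (projParam a v (P i))) ≤ s.real 10 1
  attained : s.real 10 1 = 0 ∨
    ∃ i, s.real 10 1 = dist (P i) (linePoint a v (projParam a v (P i)))

theorem wp_pointStep {s₀ s : Store} {r : ℕ} (hs₀ : Frame [6] [10] (inputStore P a v p q α) s₀)
    (hv : s₀.real 10 0 = ‖v‖ ^ 2) (h : PointInv P a v s₀ r s) (hr : s.int 6 1 < n) :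
    WP pointStep s fun t s' => ∃ r', 6 + 1 + t + (200 * d + 200) * r' ≤ (200 * d + 200) * r ∧
      PointInv P a v s₀ r' s' := by
  obtain ⟨frame, left, base, loc, param, nonneg, dist_le, attained⟩ := h
  have fr : Frame [6] [7, 10] (inputStore P a v p q α) s :=
    (hs₀.mono (by simp) (by simp)).trans frame
  have hd : s.int 0 1 = d := fr.1 0 (by simp) ▸ rfl
  obtain ⟨i, hi⟩ : ∃ i : Fin n, s.int 6 1 = i := ⟨⟨_, hr⟩, rfl⟩
  simp only [pointStep, wp_seq (c₁ := sumProg _), wp_seq (c₁ := .setR _ _ _),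
    wp_seq (c₁ := .branch _ _ _), wp_seq (c₁ := .setI _ _ _)]
  refine (wp_sumProg (d := d) hd (f := fun j => ((inputStore P a v p q α).real 3 (i * d + j) -
    (inputStore P a v p q α).real 1 j) * (inputStore P a v p q α).real 2 j) ?_).mono ?_
  · intro s' hs' _
    simp only [RExp.eval, IExp.eval, hs'.frame.2 3 (by simp), fr.2 3 (by simp),
      hs'.frame.2 1 (by simp), fr.2 1 (by simp), hs'.frame.2 2 (by simp), fr.2 2 (by simp),
      hs'.int_eq 3 (by simp), base, hi]
  rintro t₁ s₁ ⟨ht₁, fr₁, hs₁⟩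
  rw [wp_setR]
  simp only [RExp.eval, IExp.eval, RExp.cost, IExp.cost, hs₁, fr₁.real_eq 0 (by simp),
    loc 0 (by simp) (by simp), hv, sum_eq_projParam, fr₁.int_eq 1 (by simp), hi] at ht₁ ⊢
  have fr' := (fr.trans (fr₁.frame.mono (by simp) (by simp))).writeR (a := 7) (by simp) i
    (projParam a v (P i))
  refine (wp_sumProg (d := d) (by simpa [fr₁.frame.1 0] using hd)
    (f := fun j => ((inputStore P a v p q α).real 3 (i * d + j) -
    ((inputStore P a v p q α).real 1 j +
      projParam a v (P i) * (inputStore P a v p q α).real 2 j)) *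
    ((inputStore P a v p q α).real 3 (i * d + j) - ((inputStore P a v p q α).real 1 j +
      projParam a v (P i) * (inputStore P a v p q α).real 2 j))) ?_).mono ?_
  · intro s' hs' _
    have e1 := hs'.int_eq 1 (by simp)
    have e3 := hs'.int_eq 3 (by simp)
    have e7 := hs'.frame.2 7 (by simp)
    simp only [writeR_int, fr₁.int_eq 1 (by simp), fr₁.int_eq 3 (by simp), base, hi] at e1 e3
    simp only [RExp.eval, IExp.eval, hs'.frame.2 3 (by simp), fr'.2 3 (by simp),
      hs'.frame.2 1 (by simp), fr'.2 1 (by simp), hs'.frame.2 2 (by simp), fr'.2 2 (by simp),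
      e1, e3, e7]
    simp
  rintro t₂ s₂ ⟨ht₂, fr₂, hs₂⟩
  simp only [RExp.cost, IExp.cost] at ht₂
  have hsq : √(s₂.real 10 4) = dist (P i) (linePoint a v (projParam a v (P i))) := by
    rw [hs₂, sqrt_sum_eq_dist]
  have fr₃ : Frame [6] [7, 10] s₀ s₂ :=
    ((frame.trans (fr₁.frame.mono (by simp) (by simp))).writeR (a := 7) (by simp) _ _).trans
      (fr₂.frame.mono (by simp) (by simp))
  have hH := fr₂.real_eq 1 (by simp)
  simp [fr₁.real_eq] at hH
  have e1 : s₂.int 6 1 = i := by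
    rw [fr₂.int_eq 1 (by simp), writeR_int, fr₁.int_eq 1 (by simp), hi]
  -- Integer multiplication is not available; the offset of the current point is kept in a cell and
  -- increased by `d` for every point.
  have e3 : s₂.int 6 3 = i * d := by
    rw [fr₂.int_eq 3 (by simp), writeR_int, fr₁.int_eq 3 (by simp), base, hi]
  have e0 : s₂.int 0 1 = d := by
    rw [fr₂.frame.1 0 (by simp), writeR_int, fr₁.frame.1 0 (by simp), hd]
  have e7 : ∀ l : Fin n, (l : ℕ) < i + 1 → s₂.real 7 l = projParam a v (P l) := by
    intro l hl
    rw [fr₂.frame.2 7 (by simp)]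
    simp only [writeR_real, if_true]
    rcases Nat.lt_succ_iff_lt_or_eq.1 hl with hl | hl
    · rw [Function.update_of_ne hl.ne, fr₁.frame.2 7 (by simp), param l (by omega)]
    · obtain rfl := Fin.ext hl
      rw [Function.update_self]
  have e10 : ∀ c, c ≠ 1 → c ≠ 4 → s₂.real 10 c = s₀.real 10 c := by
    intro c h1 h4
    rw [fr₂.real_eq c h4, ← loc c h1 h4, ← fr₁.real_eq c h4]
    simp
  have hcost : ∀ t, t ≤ t₁ + (4 + (t₂ + 40)) →
      6 + 1 + t + (200 * d + 200) * (r - 1) ≤ (200 * d + 200) * r := by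
    intro t ht
    obtain ⟨r, rfl⟩ : ∃ r', r = r' + 1 := ⟨r - 1, by omega⟩
    simp only [Nat.add_sub_cancel, Nat.mul_add]
    omega
  simp only [wp_branch, wp_skip, wp_setI, wp_setR, IExp.eval, RExp.eval, IExp.cost, RExp.cost,
    Test.cost, Test.Holds, hsq, not_le, not_lt]
  refine ⟨fun h => ⟨r - 1, hcost _ (by omega), ?_⟩, fun h => ⟨r - 1, hcost _ (by omega), ?_⟩⟩
  · refine ⟨((fr₃.writeR (by simp) _ _).writeI (by simp) _ _).writeI (by simp) _ _, ?_, ?_,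
      fun c h1 h4 => ?_, fun l hl => ?_, ?_, fun l hl => ?_, Or.inr ⟨i, ?_⟩⟩
    · simp
      omega
    · simp [e1, e3, e0, Nat.add_mul]
    · simp [h1, e10 c h1 h4]
    · simp at hl ⊢
      exact e7 l (by omega)
    · simp
    · simp at hl ⊢
      rcases Nat.lt_or_eq_of_le hl with hl | hl
      · exact (dist_le l (by omega)).trans (hH ▸ h.le)
      · obtain rfl : l = i := Fin.ext (by omega)
        exact le_rfl
    · simp
  · refine ⟨(fr₃.writeI (by simp) _ _).writeI (by simp) _ _, ?_, ?_,
      fun c h1 h4 => ?_, fun l hl => ?_, ?_, fun l hl => ?_, ?_⟩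
    · simp
      omega
    · simp [e1, e3, e0, Nat.add_mul]
    · simp [e10 c h1 h4]
    · simp at hl ⊢
      exact e7 l (by omega)
    · simpa [hH] using nonneg
    · simp at hl ⊢
      rcases Nat.lt_or_eq_of_le hl with hl | hl
      · rw [hH]
        exact dist_le l (by omega)
      · obtain rfl : l = i := Fin.ext (by omega)
        exact h
    · simpa [hH] using attained

theorem wp_pointProg {s : Store} (hs : Frame [6] [10] (inputStore P a v p q α) s)
    (hv : s.real 10 0 = ‖v‖ ^ 2) :
    WP pointProg s fun t s' => t ≤ (200 * d + 200) * n + 20 ∧ PointInv P a v s 0 s' := by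
  have hn : s.int 0 0 = n := hs.1 0 (by simp) ▸ rfl
  simp only [pointProg, wp_seq (c₁ := .setR _ _ _), wp_seq (c₁ := .setI _ _ _), wp_setI, wp_setR,
    IExp.eval, IExp.cost, RExp.eval, RExp.cost]
  refine (wp_loop (200 * d + 200) (PointInv P a v s) (Q := PointInv P a v s 0)
    (fun r s' h hb => ?_) (fun r s' h hb => ?_) n _ ?_).mono ?_
  · simp only [Test.Holds, IExp.eval, not_le, h.frame.1 0 (by simp), hn] at hb
    exact wp_pointStep hs hv h hb
  · simp only [Test.Holds, IExp.eval, not_le, h.frame.1 0 (by simp), hn] at hb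
    have := h.left
    obtain rfl : r = 0 := by omega
    exact h
  · refine ⟨?_, ?_, ?_, fun c h1 h4 => ?_, fun i hi => ?_, ?_, fun i hi => ?_, Or.inl ?_⟩
    · exact (((Frame.refl _ _ s).writeI (by simp) _ _).writeI (by simp) _ _).writeR (by simp) _ _
    any_goals simp
    · simp [h1]
    · simp at hi
    · simp at hi
  · rintro t s' ⟨ht, h⟩
    simp only [Test.cost, IExp.cost] at ht
    exact ⟨by omega, h⟩

end Input

end RedBlue

/-! ### The whole algorithm -/

namespace RedBlue

open RealRAM

/-- The squared norm and the norm of the direction, and the separation of the parameters, are stored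
in cells `0`, `5` and `3` of the real array `10`. -/
def initProg : Prog :=
  .seq (sumProg (.mul (.get 2 (ivar 6 2)) (.get 2 (ivar 6 2))))
  (.seq (.setR 10 (.const 0) (rvar 10 4))
  (.seq (.setR 10 (.const 5) (.sqrt (rvar 10 4)))
  (.setR 10 (.const 3) (.div (rvar 0 0) (rvar 10 5)))))

/-- Output for the empty set of points. -/
def emptyProg : Prog :=
  .seq (.setR 4 (.const 0) (.const 0))
  (.seq (.setR 5 (.const 0) (rvar 10 3))
  (.seq (.setI 1 (.const 0) (.const 1))
  (.seq (.setI 1 (.const 1) (.const 1))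
  (.setR 6 (.const 0) (.const 0)))))

/-- The algorithm for at least one point. -/
def pointsProg : Prog :=
  .seq pointProg
  (.seq (sortProg 7)
  (.seq gapProg
  (.seq (sortProg 8)
  (.seq (.setI 6 (.const 0) (.sub (ivar 0 2) (.sub (ivar 0 2) (ivar 0 3))))
  (.seq searchProg outputProg)))))

/-- The approximation algorithm for constrained separated red-blue clustering. -/
def clusterProg : Prog :=
  .seq initProg (.branch (.ile (ivar 0 0) (.const 0)) emptyProg pointsProg)

section Correctness

variable {d n : ℕ} {P : Fin n → EuclideanSpace ℝ (Fin d)} {a v : EuclideanSpace ℝ (Fin d)}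
  {p q : ℕ} {α : ℝ}

/-- The state after `initProg`. -/
structure Initialized (P : Fin n → EuclideanSpace ℝ (Fin d)) (a v : EuclideanSpace ℝ (Fin d))
    (p q : ℕ) (α : ℝ) (s : Store) : Prop where
  frame : Frame [6] [10] (inputStore P a v p q α) s
  sq : s.real 10 0 = ‖v‖ ^ 2
  norm : s.real 10 5 = ‖v‖
  sep : s.real 10 3 = α / ‖v‖

theorem wp_initProg : WP initProg (inputStore P a v p q α) fun t s =>
    t ≤ 40 * d + 60 ∧ Initialized P a v p q α s := by
  simp only [initProg, wp_seq (c₁ := sumProg _), wp_seq (c₁ := .setR _ _ _)]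
  refine (wp_sumProg (d := d) rfl (f := fun j => (inputStore P a v p q α).real 2 j *
    (inputStore P a v p q α).real 2 j) ?_).mono ?_
  · intro s' hs' _
    simp only [RExp.eval, IExp.eval, hs'.frame.2 2 (by simp)]
  rintro t s ⟨ht, fr, hs⟩
  have hsum : s.real 10 4 = ‖v‖ ^ 2 := by
    rw [hs, Finset.sum_range, norm_sq_eq_sum]
    simp only [inputStore_real_two]
  simp only [RExp.cost, IExp.cost] at ht
  simp only [wp_setR, IExp.eval, RExp.eval, IExp.cost, RExp.cost]
  refine ⟨by omega, ?_, ?_, ?_, ?_⟩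
  · exact ((fr.frame.writeR (by simp) _ _).writeR (by simp) _ _).writeR (by simp) _ _
  · simp [hsum]
  · simp [hsum]
  · simp [hsum, fr.frame.2 0 (by simp)]
    rfl

/-- Without points only the separation matters: the parameters `0` and `α / ‖v‖` are exactly `α`
apart on the line, and radius `0` is optimal. -/
theorem wp_emptyProg {P : Fin 0 → EuclideanSpace ℝ (Fin d)} (hp : 0 < p) (hq : 0 < q)
    (hα : 0 ≤ α) (hv : v ≠ 0) {s : Store} (hs : Initialized P a v p q α s) :
    WP emptyProg s fun t s' => t ≤ 20 ∧ OutputsFeasible P a v p q α 0 s' ∧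
      0 ≤ 4 * optRadius P (line a v) p q α := by
  simp only [emptyProg, wp_seq, wp_setI, wp_setR, IExp.eval, IExp.cost, RExp.eval, RExp.cost]
  refine ⟨by omega, ⟨?_, ?_, ?_, ?_, ?_, le_rfl, fun i => ⟨_, rfl⟩, fun i => ⟨_, rfl⟩, ?_, ?_,
    fun i j => ?_⟩, ?_⟩
  any_goals simp
  any_goals omega
  · simp [centers, dist_linePoint, hs.sep, abs_div, abs_of_nonneg hα, hv]
  · exact Real.sInf_nonneg fun r ⟨_, _, h⟩ => h.1

theorem exists_fin_of_perm {T T' : ℕ → ℝ} (hp : (seg T 0 n).Perm (seg T' 0 n)) {f : Fin n → ℝ}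
    (hT' : ∀ i : Fin n, T' i = f i) {l : ℕ} (hl : l < n) : ∃ i, T l = f i := by
  have : T l ∈ seg T' 0 n := by
    rw [← hp.mem_iff, mem_seg]
    exact ⟨l, Nat.zero_le _, hl, rfl⟩
  obtain ⟨i, _, hi, h⟩ := mem_seg.1 this
  exact ⟨⟨i, hi⟩, by rw [← h, ← hT']⟩

theorem exists_lt_of_perm {T T' : ℕ → ℝ} (hp : (seg T 0 n).Perm (seg T' 0 n)) {f : Fin n → ℝ}
    (hT' : ∀ i : Fin n, T' i = f i) (i : Fin n) : ∃ l < n, T l = f i := by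
  have : f i ∈ seg T 0 n := by
    rw [hp.mem_iff, mem_seg]
    exact ⟨i, Nat.zero_le _, i.2, hT' i⟩
  obtain ⟨l, _, hl, h⟩ := mem_seg.1 this
  exact ⟨l, hl, h⟩

theorem wp_pointsProg (hn : 0 < n) (hp : 0 < p) (hq : 0 < q) (hα : 0 ≤ α) (hv : v ≠ 0) {s : Store}
    (hs : Initialized P a v p q α s) :
    WP pointsProg s fun t s' => t ≤ (200 * d + 1500) * (n * (Nat.clog 2 n + 1)) ∧
      ∃ R, OutputsFeasible P a v p q α R s' ∧ R ≤ 4 * optRadius P (line a v) p q α := by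
  have hn₀ : s.int 0 0 = n := hs.frame.1 0 (by simp) ▸ rfl
  have hp₀ : s.int 0 2 = p := hs.frame.1 0 (by simp) ▸ rfl
  have hq₀ : s.int 0 3 = q := hs.frame.1 0 (by simp) ▸ rfl
  simp only [pointsProg, wp_seq (c₁ := pointProg), wp_seq (c₁ := sortProg _),
    wp_seq (c₁ := gapProg), wp_seq (c₁ := .setI _ _ _), wp_seq (c₁ := searchProg)]
  refine (wp_pointProg hs.frame hs.sq).mono ?_
  rintro t₁ s₁ ⟨ht₁, h₁⟩
  have f₁ := h₁.frame
  have hleft : s₁.int 6 1 = n := by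
    have := h₁.left
    omega
  refine (wp_sortProg (X := 7) (by simp) (n := n) (by rw [f₁.1 0 (by simp), hn₀])).mono ?_
  rintro t₂ s₂ ⟨ht₂, f₂, sorted₂, perm₂⟩
  refine (wp_gapProg (n := n) (by rw [f₂.1 0 (by simp), f₁.1 0 (by simp), hn₀])).mono ?_
  rintro t₃ s₃ ⟨ht₃, f₃, gap₃⟩
  refine (wp_sortProg (X := 8) (by simp) (n := n)
    (by rw [f₃.1 0 (by simp), f₂.1 0 (by simp), f₁.1 0 (by simp), hn₀])).mono ?_
  rintro t₄ s₄ ⟨ht₄, f₄, sorted₄, perm₄⟩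
  have e0 : s₄.int 0 = s.int 0 := by
    rw [f₄.1 0 (by simp), f₃.1 0 (by simp), f₂.1 0 (by simp), f₁.1 0 (by simp)]
  have e7 : s₄.real 7 = s₂.real 7 := by rw [f₄.2 7 (by simp), f₃.2 7 (by simp)]
  have e10 : s₄.real 10 = s₁.real 10 := by
    rw [f₄.2 10 (by simp), f₃.2 10 (by simp), f₂.2 10 (by simp)]
  rw [gap₃, ← e7] at perm₄
  rw [← e7] at sorted₂ perm₂
  simp only [wp_setI, IExp.eval, IExp.cost, e0, hp₀, hq₀]
  -- The cell holds `p - (p - q)`, which is `min p q` for truncated subtraction.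
  refine (wp_searchProg (n := n) (k := min p q) ?_ hn ?_ (by omega) ?_ ?_ ?_).mono ?_
  · simpa [e0] using hn₀
  · simp
    omega
  · simpa using sorted₂
  · simpa using sorted₄
  · simpa using perm₄
  rintro t₅ s₅ ⟨ht₅, hm, r, h₅⟩
  have starts := h₅.starts
  have loc := h₅.loc
  have sep := h₅.sep
  have opt := h₅.opt
  have e7' := h₅.frame.2 7 (by simp)
  simp only [writeI_real, e10] at starts loc sep opt e7'
  refine (wp_outputProg (s := s₅) rfl).mono ?_
  rintro t₆ s₆ ⟨ht₆, hr₆, hb₆, hR₆, red, blue⟩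
  have hβ : s₅.real 10 3 = α / ‖v‖ := by
    rw [loc 3 (by simp), h₁.loc 3 (by simp) (by simp), hs.sep]
  have hnorm : s₅.real 10 5 = ‖v‖ := by
    rw [loc 5 (by simp), h₁.loc 5 (by simp) (by simp), hs.norm]
  have hβ' : α / ‖v‖ * ‖v‖ = α := div_mul_cancel₀ _ (norm_ne_zero_iff.2 hv)
  rw [← loc 3 (by simp), hβ] at sep opt
  rw [hβ, hnorm, loc 1 (by simp)] at hR₆
  rw [hβ, e7'] at red blue
  have hparam : ∀ i : Fin n, s₁.real 7 i = projParam a v (P i) :=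
    fun i => h₁.param i (by omega)
  have feas := isFeasibleSolution_of_starts (p := p) (q := q) (P := P) (a := a) hv hβ'
    (by positivity) sep starts (by omega) (by omega) h₁.nonneg (exists_lt_of_perm perm₂ hparam)
    (fun i => h₁.dist_le i (by omega)) red blue
  have hm0 := starts.pos
  have hmn := starts.count_le
  refine ⟨?_, _, ⟨by omega, by omega, by omega, by omega, hR₆, ?_⟩, ?_⟩
  -- All the partial costs are dominated by multiples of `n * (L + 1)`; after expanding the products
  -- the estimate is linear.
  · generalize Nat.clog 2 n = L at *
    have h1 : n ≤ n * (L + 1) := Nat.le_mul_of_pos_right _ (Nat.succ_pos _)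
    have h2 : L + 1 ≤ n * (L + 1) := Nat.le_mul_of_pos_left _ hn
    have h3 : d * n ≤ d * (n * (L + 1)) := Nat.mul_le_mul_left _ h1
    have h4 : n * (L + 1) = n * L + n := Nat.mul_succ n L
    simp only [Nat.add_mul, Nat.mul_add, Nat.mul_assoc, Nat.mul_one] at *
    omega
  · rw [hr₆, hb₆]
    exact feas
  · have : (‖v‖ * ((s₅.real 10 2 + α / ‖v‖) / 2) + s₁.real 10 1) / 4 ≤
        optRadius P (line a v) p q α := by
      -- The infimum is bounded below by `R / 4`; the computed solution itself shows that the set of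
      -- feasible radii is nonempty.
      refine le_csInf ⟨_, _, _, feas⟩ fun ρ hρ => ?_
      have := le_four_mul_of_isFeasibleRadius (T := s₄.real 7) hv hn hβ'
        (fun l hl => exists_fin_of_perm perm₂ hparam hl) opt h₁.attained hρ
      linarith
    linarith

theorem wp_clusterProg (hp : 0 < p) (hq : 0 < q) (hα : 0 ≤ α) (hv : v ≠ 0) :
    WP clusterProg (inputStore P a v p q α) fun t s =>
      t ≤ (240 * d + 1600) * (n * (Nat.clog 2 n + 1) + 1) ∧
      ∃ R, OutputsFeasible P a v p q α R s ∧ R ≤ 4 * optRadius P (line a v) p q α := by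
  rw [clusterProg, wp_seq]
  refine wp_initProg.mono ?_
  rintro t s ⟨ht, hs⟩
  have hn₀ : s.int 0 0 = n := hs.frame.1 0 (by simp) ▸ rfl
  simp only [wp_branch, Test.Holds, IExp.eval, Test.cost, IExp.cost, hn₀]
  refine ⟨fun h => ?_, fun h => ?_⟩
  · obtain rfl : n = 0 := by omega
    refine (wp_emptyProg hp hq hα hv hs).mono ?_
    rintro t' s' ⟨ht', h⟩
    refine ⟨?_, 0, h⟩
    simp only [Nat.zero_mul, Nat.zero_add, Nat.mul_one]
    omega
  · refine (wp_pointsProg (by omega) hp hq hα hv hs).mono ?_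
    rintro t' s' ⟨ht', h⟩
    refine ⟨?_, h⟩
    generalize n * (Nat.clog 2 n + 1) = x at *
    simp only [Nat.add_mul, Nat.mul_add, Nat.mul_assoc, Nat.mul_one] at *
    omega

end Correctness

/-- For `n ≥ 2`, `x = Real.log n` is at least `1 / 2`, so `2 * x ≤ 4 * x ^ 2` and `2 ≤ 8 * x ^ 2`.
Their sum bounds `Nat.clog 2 n + 1` and explains the `12`. The additive `1` takes care of `n < 2`,
where the logarithmic term vanishes. -/
theorem mul_clog_le (n : ℕ) :
    (n : ℝ) * (Nat.clog 2 n + 1) + 1 ≤ 12 * (n * Real.log n ^ 2 + 1) := by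
  rcases Nat.lt_or_ge n 2 with h | h
  · interval_cases n <;> norm_num
  · have hlog : (1 : ℝ) / 2 ≤ Real.log n := by
      have h2 : Real.log 2 ≤ Real.log n :=
        Real.log_le_log (by norm_num) (by exact_mod_cast h)
      linarith [Real.log_two_gt_d9]
    have hclog : (Nat.clog 2 n : ℝ) ≤ 2 * Real.log n + 1 := by
      have h1 : (Nat.clog 2 n : ℝ) ≤ Nat.log 2 n + 1 := by
        exact_mod_cast Nat.clog_le_of_le_pow (Nat.lt_pow_succ_log_self one_lt_two n).le
      have h2 := Real.natLog_le_logb n 2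
      rw [Real.logb, Nat.cast_two] at h2
      have h3 : Real.log n / Real.log 2 ≤ 2 * Real.log n := by
        rw [div_le_iff₀ (Real.log_pos one_lt_two)]
        nlinarith [Real.log_two_gt_d9]
      linarith
    have h1 : (Nat.clog 2 n : ℝ) + 1 ≤ 12 * Real.log n ^ 2 := by nlinarith
    have := mul_le_mul_of_nonneg_left h1 (Nat.cast_nonneg (α := ℝ) n)
    linarith

end RedBlue

theorem mainTheorem4 :
    ∃ A : RealRAM.Prog, ∀ d : ℕ, ∃ C : ℝ,
      ∀ (n p q : ℕ) (α : ℝ) (P : Fin n → EuclideanSpace ℝ (Fin d))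
        (a v : EuclideanSpace ℝ (Fin d)),
        0 < p → 0 < q → 0 ≤ α → v ≠ 0 →
        ∃ (t : ℕ) (s : RealRAM.Store) (R : ℝ),
          RealRAM.Exec A (RedBlue.inputStore P a v p q α) t s ∧
          (t : ℝ) ≤ C * ((n : ℝ) * Real.log (n : ℝ) ^ 2 + 1) ∧
          RedBlue.OutputsFeasible P a v p q α R s ∧
          R ≤ 4 * RedBlue.optRadius P (RedBlue.line a v) p q α := by
  refine ⟨RedBlue.clusterProg, fun d => ⟨(240 * d + 1600) * 12, ?_⟩⟩
  intro n p q α P a v hp hq hα hv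
  obtain ⟨t, s, he, ht, R, hR, hopt⟩ :=
    RedBlue.wp_clusterProg (P := P) (a := a) hp hq hα hv
  refine ⟨t, s, R, he, ?_, hR, hopt⟩
  have h1 : (t : ℝ) ≤ (240 * d + 1600) * (n * (Nat.clog 2 n + 1) + 1) := by exact_mod_cast ht
  refine h1.trans ?_
  rw [mul_assoc]
  exact mul_le_mul_of_nonneg_left (RedBlue.mul_clog_le n) (by positivity)
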